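/- **Setting.** Let $n\ge 2$ and $1>m_1\ge m_2\ge\dots\ge m_n>0$. Let $\mathcal P(V,\{m_i\})$ be the set of probability distributions $F$ of value profiles $v$ on $V=[0,1]^n$ with $E_F[v_i]=m_i$ for all $i$, and $\mathcal I$ the set of private-value information structures: bidder $i$ observes his value $v_i$ and a signal $s_i$ (in a standard Borel space), where $s=(s_1,\dots,s_n)$ is drawn from a Markov kernel given $v$. $I_0$ is the structure with trivial signals. **Mechanisms.** A mechanism $M$ is given by the direct mechanism $(x,t)$ that it induces in each environment $(F,I)$: measurable allocations $x_i\in[0,1]$ and payments $t_i\in\mathbb R$, integrable under $(F,I)$, as functions of the reported types $(v,s)$ (under $I_0$: of the reported values only). Its revenue is $\mathcal R(F,I,M)=\sum_iE_{(F,I)}[t_i]$. It is Bayesian IR and IC in $(F,I)$ if for every $i$ and almost every type $\tau=(v_i,s_i)$ the interim utility $U_i(\hat\tau\mid\tau)=E[v_ix_i(\hat\tau,\cdot)-t_i(\hat\tau,\cdot)\mid\tau]$ satisfies $U_i(\tau\mid\tau)\ge0$, and $U_i(\tau\mid\tau)\ge U_i(\hat\tau\mid\tau)$ for all reports $\hat\tau$.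 A value $a$ of bidder $i$ is *non-competitive* under $F$ if $a$ is the minimum of the support of the $i$-th marginal of $F$ and, conditional on $v_i=a$, with probability one there is another bidder $j$ with $v_j>a$. $M$ is *competitive* ($M\in\hat{\mathcal M}$) if in every environment $(F,I)\in\mathcal P(V,\{m_i\})\times\mathcal I$ it is Bayesian IR and IC and almost surely $x_i=0$ whenever $v_i$ is non-competitive under $F$. For a distribution $G$ on $[0,1]$, $S_G$ is the second-price auction with common random reserve price $r\sim G$, in which bidders bid their values: in every environment $$x_i(v)=G(v_i)\,w_i(v),\qquad t_i(v)=E_{r\sim G}\big[\max\{v^{(2)},r\}\mathbf 1_{\{v^{(1)}>r\}}\big]\,w_i(v),$$ where $G(\cdot)$ is the distribution function, $v^{(1)}\ge v^{(2)}$ are the two highest components of $v$, $w_i(v)=0$ if $v_i<v^{(1)}$, and $w_i(v)=1/\#\{j:v_j=v^{(1)}\}$ if $v_i=v^{(1)}$. **The strategies.** For $1\le\ell\le n$ let $\bar m_\ell=\frac1\ell\sum_{i\le\ell}m_i$ and let $\alpha_\ell$ be the unique $a\in(0,1)$ with $\bar m_\ell=a(1-\frac1\ell\ln a)$. Let $k$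 be the least $\ell\in\{1,\dots,n\}$ with $m_j>\alpha_\ell$ for $j\le\ell$ and $m_p\le\alpha_\ell$ for $p>\ell$, and put $\alpha=\alpha_k$, $\theta_i=\frac{m_i-\alpha}{-\alpha\ln\alpha}$ for $i\le k$. Let $H$ be the law on $(\alpha,1]$ with density $\alpha/x^2$ on $(\alpha,1)$ and an atom of mass $\alpha$ at $1$. $F^*$ is the following distribution of $v$: choose one of the bidders $1,\dots,k$, bidder $i$ with probability $\theta_i$; the chosen bidder's value is drawn from $H$, the other bidders among $1,\dots,k$ have value $\alpha$, and each bidder $l>k$ has value $m_l$. $G^*$ has an atom of mass $\frac{k-1}{k-1-\ln\alpha}$ at $0$ and density $\frac{1}{p\,(k-1-\ln\alpha)}$ on $[\alpha,1]$. **Theorem.** $G^*$ is a probability distribution on $[0,1]$, $F^*\in\mathcal P(V,\{m_i\})$, and $S_{G^*}\in\hat{\mathcal M}$, with $\sum_ix_i\le1$ on $V$. For all $M\in\hat{\mathcal M}$ and $(F,I)\in\mathcal P(V,\{m_i\})\times\mathcal I$, $$\mathcal R(F^*,I_0,M)\le\mathcal R(F^*,I_0,S_{G^*})\le\mathcal R(F,I,S_{G^*}).$$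 The first inequality holds more generally for the revenue of every direct mechanism $(x,t)$, a function of the reported values, that satisfies the conditions of competitiveness in the single environment $(F^*,I_0)$. Consequently $$S_{G^*}\in\arg\max_{M\in\hat{\mathcal M}}\ \inf_{(F,I)}\mathcal R(F,I,M).$$ -/

import Mathlib

open MeasureTheory ProbabilityTheory Set
open scoped ENNReal

namespace RobustAuction

noncomputable section

/-! ## Value distributions -/

/-- Valuation profiles; the bidders are indexed by `Fin n`. The set `V = [0,1]ⁿ` is
`Icc (0 : Values n) 1`. -/
abbrev Values (n : ℕ) : Type := Fin n → ℝ

/-- `F ∈ 𝒫(V, {mᵢ})`: `F` is a probability measure concentrated on `V = [0,1]ⁿ` whose `i`-th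
marginal has mean `mᵢ`. -/
structure IsFeasible {n : ℕ} (m : Fin n → ℝ) (F : Measure (Values n)) : Prop where
  isProb : IsProbabilityMeasure F
  ae_mem : ∀ᵐ v ∂F, v ∈ Icc (0 : Values n) 1
  mean_eq : ∀ i, ∫ v, v i ∂F = m i

/-- The set `𝒫(V, {mᵢ})`. -/
abbrev Feasible {n : ℕ} (m : Fin n → ℝ) : Type := {F : Measure (Values n) // IsFeasible m F}

instance {n : ℕ} {m : Fin n → ℝ} (F : Feasible m) : IsProbabilityMeasure F.1 := F.2.isProb

/-! ## Information structures -/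

/-- A private-value information structure: besides the own value `vᵢ`, bidder `i` observes a signal
in `Sig i`; the signal profile is drawn from `κ v` given the value profile `v`
(signals of different bidders may be correlated). -/
structure InfoStructure (n : ℕ) where
  Sig : Fin n → Type
  [measurableSpace : ∀ i, MeasurableSpace (Sig i)]
  [standardBorel : ∀ i, StandardBorelSpace (Sig i)]
  [nonempty : ∀ i, Nonempty (Sig i)]
  κ : Kernel (Values n) (∀ i, Sig i)
  [isMarkov : IsMarkovKernel κ]

attribute [instance] InfoStructure.measurableSpace InfoStructure.standardBorel
  InfoStructure.nonempty InfoStructure.isMarkov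

/-- The null information structure `I₀`: all signals are trivial. -/
def InfoStructure.null (n : ℕ) : InfoStructure n where
  Sig := fun _ => Unit
  κ := Kernel.const _ (Measure.dirac fun _ => ())

/-- Realizations of values and signals. -/
abbrev InfoStructure.Profile {n : ℕ} (I : InfoStructure n) : Type := Values n × (∀ i, I.Sig i)

/-- The type of bidder `i`: the own value and the own signal. -/
abbrev InfoStructure.OwnType {n : ℕ} (I : InfoStructure n) (i : Fin n) : Type := ℝ × I.Sig i

/-- The type of bidder `i` at a profile. -/
def InfoStructure.ownType {n : ℕ} (I : InfoStructure n) (i : Fin n) (ω : I.Profile) :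
    I.OwnType i := (ω.1 i, ω.2 i)

/-- The profile obtained from `ω` when bidder `i` reports the type `r`. -/
def InfoStructure.report {n : ℕ} (I : InfoStructure n) (i : Fin n) (r : I.OwnType i)
    (ω : I.Profile) : I.Profile := (Function.update ω.1 i r.1, Function.update ω.2 i r.2)

/-- The joint law of values and signals under `(F, I)`. -/
def law {n : ℕ} (F : Measure (Values n)) (I : InfoStructure n) : Measure I.Profile := F ⊗ₘ I.κ

instance {n : ℕ} (F : Measure (Values n)) [IsProbabilityMeasure F] (I : InfoStructure n) :
    IsProbabilityMeasure (law F I) := by unfold law; infer_instance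

/-! ## Direct mechanisms -/

/-- A direct mechanism for the information structure `I`: allocations and payments as functions of
the reported types. For the null information structure these are functions of the reported values
only. -/
structure DirectMechanism {n : ℕ} (I : InfoStructure n) where
  x : Fin n → I.Profile → ℝ
  t : Fin n → I.Profile → ℝ

namespace DirectMechanism

variable {n : ℕ} {I : InfoStructure n}

/-- The regularity that is part of the notion of a direct mechanism: allocation probabilities on
`V` lie in `[0,1]`, all functions are measurable and the expected payments exist. -/
structure IsRegular (D : DirectMechanism I) (F : Measure (Values n)) : Prop where
  measurable_x : ∀ i, Measurable (D.x i)
  measurable_t : ∀ i, Measurable (D.t i)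
  x_mem : ∀ i, ∀ ω : I.Profile, ω.1 ∈ Icc (0 : Values n) 1 → D.x i ω ∈ Icc (0 : ℝ) 1
  integrable_t : ∀ i, Integrable (D.t i) (law F I)

/-- The expected revenue `Σᵢ E_{(F,I)}[tᵢ]`. -/
def revenue (D : DirectMechanism I) (F : Measure (Values n)) : ℝ :=
  ∑ i, ∫ ω, D.t i ω ∂(law F I)

/-- The interim utility of bidder `i` of type `τ` (own value and signal) who reports `r`: the
conditional expectation, given the true type `τ`, of value times allocation minus payment. -/
def interimUtility (D : DirectMechanism I) (F : Measure (Values n)) [IsProbabilityMeasure F]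
    (i : Fin n) (r τ : I.OwnType i) : ℝ :=
  ∫ ω, (τ.1 * D.x i (I.report i r ω) - D.t i (I.report i r ω))
    ∂(condDistrib id (I.ownType i) (law F I) τ)

/-- Bayesian individual rationality: truthful reporting gives nonnegative interim utility (for
almost every type, as conditional laws are determined only up to null sets of types). -/
def IsIR (D : DirectMechanism I) (F : Measure (Values n)) [IsProbabilityMeasure F] : Prop :=
  ∀ i, ∀ᵐ τ ∂((law F I).map (I.ownType i)), 0 ≤ D.interimUtility F i τ τ

/-- Bayesian incentive compatibility: no report `r` with a value in `[0,1]` does better than the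
truth. Together with individual rationality, reports whose payoff is not integrable impose no
constraint here. -/
def IsIC (D : DirectMechanism I) (F : Measure (Values n)) [IsProbabilityMeasure F] : Prop :=
  ∀ i, ∀ᵐ τ ∂((law F I).map (I.ownType i)), ∀ r : I.OwnType i, r.1 ∈ Icc (0 : ℝ) 1 →
    D.interimUtility F i r τ ≤ D.interimUtility F i τ τ

end DirectMechanism

/-- `γᵢ(F)`: the value `a` of bidder `i` is non-competitive under `F` if it is the minimum of the
support of the `i`-th marginal and, conditional on `vᵢ = a`, with probability one some bidder has
a value above `a`. (An elementary conditional probability given a null event is `0` in Mathlib, so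
a value of probability zero does not qualify; such values are immaterial below.) -/
def NonCompetitive {n : ℕ} (F : Measure (Values n)) (i : Fin n) (a : ℝ) : Prop :=
  IsLeast (F.map fun v => v i).support a ∧ (F[|{v | v i = a}]) {v | ∃ j, a < v j} = 1

/-- The direct mechanism `D` is competitive in the environment `(F, I)`: it is Bayesian IR and IC
and almost surely does not assign the good to a non-competitive type. -/
structure DirectMechanism.IsCompetitive {n : ℕ} {I : InfoStructure n} (D : DirectMechanism I)
    {m : Fin n → ℝ} (F : Feasible m) : Prop where
  regular : D.IsRegular F.1
  ir : D.IsIR F.1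
  ic : D.IsIC F.1
  noncompetitive : ∀ i, ∀ᵐ ω ∂(law F.1 I), NonCompetitive F.1 i (ω.1 i) → D.x i ω = 0

/-! ## Mechanisms -/

/-- A mechanism, represented by the direct mechanism that it induces (as the outcome of bidders'
equilibrium play) in every environment `(F, I)`. -/
abbrev Mechanism {n : ℕ} (m : Fin n → ℝ) : Type 1 :=
  Feasible m → (I : InfoStructure n) → DirectMechanism I

namespace Mechanism

variable {n : ℕ} {m : Fin n → ℝ}

/-- `ℛ(F, I, M)`. -/
def revenue (F : Feasible m) (I : InfoStructure n) (M : Mechanism m) : ℝ := (M F I).revenue F.1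

/-- The set of competitive mechanisms. -/
def competitive (m : Fin n → ℝ) : Set (Mechanism m) :=
  {M | ∀ F I, (M F I).IsCompetitive F}

/-- The revenue guarantee `inf_{F,I} ℛ(F, I, M)`, an extended real number. -/
def guarantee (M : Mechanism m) : EReal := ⨅ (F : Feasible m) (I : InfoStructure n),
  (revenue F I M : EReal)

end Mechanism

/-! ## Second-price auctions with a random reserve price -/

/-- The highest component `v⁽¹⁾`. -/
def highest {n : ℕ} (v : Values n) : ℝ := ⨆ i, v i

/-- The second highest component `v⁽²⁾` (with multiplicity): the largest minimum of two
components with different indices. -/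
def secondHighest {n : ℕ} (v : Values n) : ℝ :=
  ⨆ p : {p : Fin n × Fin n // p.1 ≠ p.2}, min (v p.1.1) (v p.1.2)

open Classical in
/-- The probability that bidder `i` is selected as the highest bidder; ties are broken
uniformly. -/
def winShare {n : ℕ} (i : Fin n) (v : Values n) : ℝ :=
  if v i = highest v then 1 / ((Finset.univ.filter fun j => v j = highest v).card : ℝ) else 0

/-- The second-price auction `S_G` with a common random reserve price `r ∼ G`; the bidders bid
their values, so that the outcome is independent of `F` and of the signals. -/
def secondPrice {n : ℕ} {m : Fin n → ℝ} (G : Measure ℝ) : Mechanism m := fun _ _ =>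
  { x := fun i ω => G.real (Iic (ω.1 i)) * winShare i ω.1
    t := fun i ω =>
      (∫ r, if r < highest ω.1 then max (secondHighest ω.1) r else 0 ∂G) * winShare i ω.1 }

/-! ## The equilibrium strategies -/

/-- `αₗ(y)`: the (unique) `a ∈ (0,1)` with `y = a (1 - ln a / ℓ)`. -/
def lowerRoot (l : ℕ) (y : ℝ) : ℝ := sInf {a | a ∈ Ioo (0 : ℝ) 1 ∧ y = a * (1 - Real.log a / l)}

variable {n : ℕ} (m : Fin n → ℝ)

/-- The average of the first `ℓ` means. -/
def avgMean (l : ℕ) : ℝ := (∑ i : Fin n with i.val < l, m i) / l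

/-- The number `k` of active bidders. The first `ℓ` bidders are those with index `i.val < ℓ`. -/
def cutoff : ℕ := sInf {l | 1 ≤ l ∧ l ≤ n ∧
  (∀ j : Fin n, j.val < l → lowerRoot l (avgMean m l) < m j) ∧
  (∀ p : Fin n, l ≤ p.val → m p ≤ lowerRoot l (avgMean m l))}

/-- `α = αₖ(m̄ₖ)`. -/
def alpha : ℝ := lowerRoot (cutoff m) (avgMean m (cutoff m))

/-- The law `H` of the highest value: density `α / x²` on `(α, 1)` and an atom of mass `α` at `1`;
its distribution function is `(x - α) / x` on `(α, 1)`. -/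
def highLaw (a : ℝ) : Measure ℝ :=
  (volume.restrict (Ioo a 1)).withDensity (fun x => ENNReal.ofReal (a / x ^ 2))
    + ENNReal.ofReal a • Measure.dirac 1

/-- The probability `θᵢ` that the active bidder `i` is the highest bidder. -/
def theta (i : Fin n) : ℝ := (m i - alpha m) / (-(alpha m * Real.log (alpha m)))

/-- The value profile `𝐯ᵢ(x)`: bidder `i` has value `x`, all other active bidders have value `α`,
and every inactive bidder `l` has value `mₗ`. -/
def activeProfile (i : Fin n) (x : ℝ) : Values n :=
  Function.update (fun j => if j.val < cutoff m then alpha m else m j) i x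

/-- The worst-case distribution `F*`. -/
def worstCase : Measure (Values n) :=
  ∑ i : Fin n with i.val < cutoff m,
    ENNReal.ofReal (theta m i) • (highLaw (alpha m)).map (activeProfile m i)

/-- The optimal random reserve price `G*`: an atom of mass `(k-1)/(k-1-ln α)` at `0` and density
`1 / (p (k-1-ln α))` on `[α, 1]`. -/
def optimalReserve : Measure ℝ :=
  ENNReal.ofReal (((cutoff m : ℝ) - 1) / ((cutoff m : ℝ) - 1 - Real.log (alpha m))) •
      Measure.dirac 0
    + (volume.restrict (Icc (alpha m) 1)).withDensity
      (fun p => ENNReal.ofReal (1 / (p * ((cutoff m : ℝ) - 1 - Real.log (alpha m)))))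

end

end RobustAuction

open RobustAuction

namespace RobustAuction

section

/-! ## The cutoff and the parameter `α` -/

/-! The pair `(F*, I₀)`, `S_{G*}` is a saddle point of value `α`: no competitive mechanism earns
more than `α` at `(F*, I₀)`, and `S_{G*}` earns at least `α` everywhere.

Upper bound. Under `F*` almost surely exactly one bidder, an active one, has a value above `α`. All
others sit at the bottom of their supports and are non-competitive: they receive nothing, so
individual rationality makes their expected payments nonpositive
(`integral_payment_lowTypes_nonpos`). An active bidder with a value above `α` can infer the whole
profile, so his interim constraints are those of a single buyer whose value has law `H`
(`integral_payment_active_le`). `H` is an equal-revenue law: every posted price in `(α, 1]` sells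
with probability `α / p`, and no single-buyer mechanism extracts more than `α`
(`integral_payment_highLaw_le`). The weights `θᵢ` sum to `1`, hence `revenue_le_alpha`.

Lower bound. With `c = k - 1 - ln α`, the density `1 / (p c)` of `G*` makes `c` times the winner's
payment equal to `(k - 1) v⁽²⁾ + ∫ max(v⁽²⁾, p) / p` over `p ∈ [α, 1]`, `p < v⁽¹⁾`. This is at least
`(k - 1) v⁽²⁾ + v⁽¹⁾ - α`, hence at least the sum of the active values minus `α`
(`le_winnerPayment`). That minorant is affine, so its expectation depends only on the means, and the
equation defining `α` says that it is `α c`. On the profiles of `F*` all these inequalities are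
equalities (`winnerPayment_activeProfile`), so `S_{G*}` earns exactly `α` there.

Competitiveness of `S_{G*}` holds in every environment because truthful bidding is optimal ex post
(`expostPayoff_le`, `expostPayoff_self`), and a bidder with a strictly higher rival never wins. -/

lemma root_lt_root {l : ℕ} (hl : 1 ≤ l) {a b : ℝ} (ha : 0 < a) (hab : a < b) (hb : b ≤ 1) :
    a * (1 - Real.log a / l) < b * (1 - Real.log b / l) := by
  have hl' : (1 : ℝ) ≤ l := by exact_mod_cast hl
  have hlog : Real.log b ≤ 0 := Real.log_nonpos (by linarith) hb
  -- The tangent bound `log t < t - 1` at `t = b / a` takes the place of a derivative.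
  have hdiv : Real.log (b / a) < b / a - 1 :=
    Real.log_lt_sub_one_of_pos (div_pos (ha.trans hab) ha) (by
      rw [Ne, div_eq_one_iff_eq ha.ne']; exact hab.ne')
  rw [Real.log_div (ha.trans hab).ne' ha.ne'] at hdiv
  have h1 : a * (Real.log b - Real.log a) < b - a := by
    calc a * (Real.log b - Real.log a) < a * (b / a - 1) := by gcongr
      _ = b - a := by field_simp
  -- The left side is `(b - a) log b + a (log b - log a)`, whose first term is nonpositive.
  have h2 : b * Real.log b - a * Real.log a < b - a := by nlinarith
  have h3 : (b * Real.log b - a * Real.log a) / l < b - a := by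
    rw [div_lt_iff₀ (by linarith)]; nlinarith
  have h4 : (b * Real.log b - a * Real.log a) / l
      = b * (Real.log b / l) - a * (Real.log a / l) := by ring
  linarith

/-- The function is continuous with values `0` at `0` and `1` at `1`, and strictly increasing in
between. So the set whose infimum defines `lowerRoot` is a singleton. -/
lemma lowerRoot_spec {l : ℕ} (hl : 1 ≤ l) {y : ℝ} (hy : y ∈ Ioo (0 : ℝ) 1) :
    lowerRoot l y ∈ Ioo (0 : ℝ) 1 ∧ y = lowerRoot l y * (1 - Real.log (lowerRoot l y) / l) := by
  have hcont : Continuous fun a : ℝ => a * (1 - Real.log a / l) := by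
    have : (fun a : ℝ => a * (1 - Real.log a / l)) = fun a => a - (a * Real.log a) / l := by
      ext; ring
    rw [this]
    exact continuous_id.sub (Real.continuous_mul_log.div_const _)
  have hivt := intermediate_value_Ioo (zero_le_one (α := ℝ)) hcont.continuousOn
  simp only [zero_mul, Real.log_one, zero_div, sub_zero, mul_one] at hivt
  obtain ⟨a, ha, hay⟩ := hivt hy
  have hset : {a | a ∈ Ioo (0 : ℝ) 1 ∧ y = a * (1 - Real.log a / l)} = {a} := by
    refine Set.eq_singleton_iff_unique_mem.2 ⟨⟨ha, hay.symm⟩, ?_⟩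
    rintro b ⟨hb, hby⟩
    rcases lt_trichotomy a b with h | h | h
    · have := root_lt_root hl ha.1 h hb.2.le
      simp only at hay; linarith
    · exact h.symm
    · have := root_lt_root hl hb.1 h ha.2.le
      simp only at hay; linarith
  have : lowerRoot l y = a := by rw [lowerRoot, hset, csInf_singleton]
  rw [this]
  exact ⟨ha, hay.symm⟩

lemma le_lowerRoot {l : ℕ} (hl : 1 ≤ l) {y b : ℝ} (hy : y ∈ Ioo (0 : ℝ) 1) (hb : b ∈ Ioo (0 : ℝ) 1)
    (h : b * (1 - Real.log b / l) ≤ y) : b ≤ lowerRoot l y := by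
  obtain ⟨h1, h2⟩ := lowerRoot_spec hl hy
  by_contra! hlt
  have := root_lt_root hl h1.1 hlt hb.2.le
  linarith

lemma lowerRoot_lt {l : ℕ} (hl : 1 ≤ l) {y : ℝ} (hy : y ∈ Ioo (0 : ℝ) 1) : lowerRoot l y < y := by
  obtain ⟨h1, h2⟩ := lowerRoot_spec hl hy
  have hl' : (0 : ℝ) < l := by exact_mod_cast hl
  have : 0 < -Real.log (lowerRoot l y) / l :=
    div_pos (by linarith [Real.log_neg h1.1 h1.2]) hl'
  have h3 := mul_pos h1.1 this
  have h4 : lowerRoot l y * (1 - Real.log (lowerRoot l y) / l) =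
    lowerRoot l y + lowerRoot l y * (-Real.log (lowerRoot l y) / l) := by ring
  linarith

variable {n : ℕ} {m : Fin n → ℝ}

lemma card_filter_val_lt {l : ℕ} (hl : l ≤ n) :
    (Finset.univ.filter fun i : Fin n => i.val < l).card = l := by
  rw [Fin.card_filter_val_lt, min_eq_right hl]

lemma avgMean_mem (hm : ∀ i, m i ∈ Ioo (0 : ℝ) 1) {l : ℕ} (hl : 1 ≤ l) (hln : l ≤ n) :
    avgMean m l ∈ Ioo (0 : ℝ) 1 := by
  have hl' : (0 : ℝ) < l := by exact_mod_cast hl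
  have hne : (Finset.univ.filter fun i : Fin n => i.val < l).Nonempty :=
    ⟨⟨0, by omega⟩, by simp; omega⟩
  constructor
  · exact div_pos (Finset.sum_pos (fun i _ => (hm i).1) hne) hl'
  · rw [avgMean, div_lt_one hl']
    calc _ < ∑ i : Fin n with i.val < l, (1 : ℝ) :=
          Finset.sum_lt_sum_of_nonempty hne fun i _ => (hm i).2
      _ = l := by simp [card_filter_val_lt hln]

lemma mul_avgMean {l : ℕ} (hl : 1 ≤ l) : l * avgMean m l = ∑ i : Fin n with i.val < l, m i := by
  have hl' : (l : ℝ) ≠ 0 := by positivity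
  rw [avgMean, mul_div_cancel₀ _ hl']

lemma sum_filter_val_lt_succ (f : Fin n → ℝ) {l : ℕ} (hl : l < n) :
    ∑ i : Fin n with i.val < l + 1, f i = (∑ i : Fin n with i.val < l, f i) + f ⟨l, hl⟩ := by
  have : (Finset.univ.filter fun i : Fin n => i.val < l + 1)
      = insert ⟨l, hl⟩ (Finset.univ.filter fun i : Fin n => i.val < l) := by
    ext i
    simp only [Finset.mem_filter, Finset.mem_univ, true_and, Finset.mem_insert, Fin.ext_iff]
    omega
  rw [this, Finset.sum_insert (by simp), add_comm]

/-- Only the existence of an admissible `ℓ` is at stake. The largest `ℓ` whose first `ℓ` means all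
exceed `αₗ` is admissible, because failure at `ℓ + 1` bounds the next mean by the root at `ℓ + 1`,
which is at most `αₗ`. -/
lemma cutoff_mem (hn : 1 ≤ n) (hm : ∀ i, m i ∈ Ioo (0 : ℝ) 1) (hanti : Antitone m) :
    1 ≤ cutoff m ∧ cutoff m ≤ n ∧ (∀ j : Fin n, j.val < cutoff m → alpha m < m j) ∧
      (∀ p : Fin n, cutoff m ≤ p.val → m p ≤ alpha m) := by
  suffices h : {l | 1 ≤ l ∧ l ≤ n ∧
      (∀ j : Fin n, j.val < l → lowerRoot l (avgMean m l) < m j) ∧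
      (∀ p : Fin n, l ≤ p.val → m p ≤ lowerRoot l (avgMean m l))}.Nonempty from Nat.sInf_mem h
  let P : ℕ → Prop := fun l => 1 ≤ l ∧ l ≤ n ∧
    ∀ j : Fin n, j.val < l → lowerRoot l (avgMean m l) < m j
  have hP1 : P 1 := by
    refine ⟨le_rfl, hn, fun j hj => ?_⟩
    have h0 : j = ⟨0, by omega⟩ := Fin.ext (by simpa using hj)
    have h1 := mul_avgMean (m := m) le_rfl
    have h2 := sum_filter_val_lt_succ m (l := 0) (by omega)
    simp only [Nat.not_lt_zero, Finset.filter_false, Finset.sum_empty, zero_add,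
      Nat.cast_one, one_mul] at h1 h2
    rw [h0, ← h2, ← h1]
    exact lowerRoot_lt le_rfl (avgMean_mem hm le_rfl hn)
  obtain ⟨l, ⟨hl1, hln, hlm⟩, hmax⟩ : ∃ l, P l ∧ ∀ l', P l' → l' ≤ l := by
    classical
    refine ⟨Nat.findGreatest P n, Nat.findGreatest_spec hn hP1, fun l' h => ?_⟩
    exact Nat.le_findGreatest h.2.1 h
  refine ⟨l, hl1, hln, hlm, fun p hp => ?_⟩
  have hl : l < n := hp.trans_lt p.2
  set b := lowerRoot (l + 1) (avgMean m (l + 1)) with hb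
  have hy := avgMean_mem hm (l := l + 1) (by omega) hl
  obtain ⟨hb1, hb2⟩ := lowerRoot_spec (l := l + 1) (by omega) hy
  -- The means decrease, so if the last of the first `l + 1` bidders were above `b`, all of them
  -- would be, against the maximality of `l`.
  have hml : m ⟨l, hl⟩ ≤ b := by
    by_contra! hlt
    have : P (l + 1) := ⟨by omega, hl, fun j hj => hlt.trans_le (hanti (by
      rw [Fin.le_def]; simp only; omega))⟩
    have := hmax _ this
    omega
  -- Removing the last bidder from the equation for `b` removes his mean on one side and `b` on the
  -- other; as that mean is at most `b`, the equation at `l` becomes an inequality for `b`.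
  have hbl : b ≤ lowerRoot l (avgMean m l) := by
    refine le_lowerRoot hl1 (avgMean_mem hm hl1 hln) hb1 ?_
    have h1 := mul_avgMean (m := m) hl1
    have h2 := mul_avgMean (m := m) (l := l + 1) (by omega)
    rw [sum_filter_val_lt_succ m hl, ← h1, hb2, ← hb] at h2
    have hl0 : (0 : ℝ) < l := by exact_mod_cast hl1
    have h3 : ((l + 1 : ℕ) : ℝ) * (b * (1 - Real.log b / (l + 1 : ℕ)))
        = b * (l + 1) - b * Real.log b := by
      push_cast; field_simp
    have h4 : (l : ℝ) * (b * (1 - Real.log b / l)) = b * l - b * Real.log b := by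
      field_simp
    refine le_of_mul_le_mul_left ?_ hl0
    rw [h4]; linarith
  exact (hanti (show (⟨l, hl⟩ : Fin n) ≤ p from hp)).trans (hml.trans hbl)

lemma alpha_spec (hn : 1 ≤ n) (hm : ∀ i, m i ∈ Ioo (0 : ℝ) 1) (hanti : Antitone m) :
    alpha m ∈ Ioo (0 : ℝ) 1 ∧ ∑ i : Fin n with i.val < cutoff m, m i
      = alpha m * (cutoff m - Real.log (alpha m)) := by
  obtain ⟨h1, h2, -⟩ := cutoff_mem hn hm hanti
  obtain ⟨h3, h4⟩ := lowerRoot_spec h1 (avgMean_mem hm h1 h2)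
  refine ⟨h3, ?_⟩
  have hl0 : (0 : ℝ) < cutoff m := by exact_mod_cast h1
  rw [← mul_avgMean h1, h4]
  change _ * (alpha m * (1 - Real.log (alpha m) / _)) = _
  field_simp

lemma neg_mul_log_pos {a : ℝ} (ha : a ∈ Ioo (0 : ℝ) 1) : 0 < -(a * Real.log a) := by
  have := mul_neg_of_pos_of_neg ha.1 (Real.log_neg ha.1 ha.2)
  linarith

lemma theta_pos (hn : 1 ≤ n) (hm : ∀ i, m i ∈ Ioo (0 : ℝ) 1) (hanti : Antitone m) {i : Fin n}
    (hi : i.val < cutoff m) : 0 < theta m i := by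
  refine div_pos ?_ (neg_mul_log_pos (alpha_spec hn hm hanti).1)
  linarith [(cutoff_mem hn hm hanti).2.2.1 i hi]

/-- The equation defining `α` says exactly that the excesses `mᵢ - α` of the active bidders add up
to `-α ln α`. -/
lemma sum_theta (hn : 1 ≤ n) (hm : ∀ i, m i ∈ Ioo (0 : ℝ) 1) (hanti : Antitone m) :
    ∑ i : Fin n with i.val < cutoff m, theta m i = 1 := by
  obtain ⟨h1, h2⟩ := alpha_spec hn hm hanti
  have h3 := neg_mul_log_pos h1
  simp only [theta]
  rw [← Finset.sum_div, div_eq_one_iff_eq h3.ne', Finset.sum_sub_distrib, h2, Finset.sum_const,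
    card_filter_val_lt (cutoff_mem hn hm hanti).2.1, nsmul_eq_mul]
  ring

lemma theta_mul (hn : 1 ≤ n) (hm : ∀ i, m i ∈ Ioo (0 : ℝ) 1) (hanti : Antitone m) (i : Fin n) :
    theta m i * (-(alpha m * Real.log (alpha m))) = m i - alpha m :=
  div_mul_cancel₀ _ (neg_mul_log_pos (alpha_spec hn hm hanti).1).ne'

lemma normalizer_pos (hn : 1 ≤ n) (hm : ∀ i, m i ∈ Ioo (0 : ℝ) 1) (hanti : Antitone m) :
    0 < (cutoff m : ℝ) - 1 - Real.log (alpha m) := by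
  obtain ⟨h1, -⟩ := alpha_spec hn hm hanti
  have h2 := Real.log_neg h1.1 h1.2
  have h3 : (1 : ℝ) ≤ cutoff m := by exact_mod_cast (cutoff_mem hn hm hanti).1
  linarith

end

section

/-! ## The law `H` -/

lemma integral_div_sq {a b c : ℝ} (ha : 0 < a) (hab : a ≤ b) :
    ∫ x in Ioo a b, c / x ^ 2 = c * (1 / a - 1 / b) := by
  rw [← integral_Ioc_eq_integral_Ioo, ← intervalIntegral.integral_of_le hab,
    intervalIntegral.integral_eq_sub_of_hasDerivAt (f := fun x => -(c / x))]
  · ring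
  · intro x hx
    rw [uIcc_of_le hab] at hx
    have hx0 : x ≠ 0 := (ha.trans_le hx.1).ne'
    have := ((hasDerivAt_inv hx0).const_mul c).neg
    refine (this.congr_deriv ?_)
    field_simp
  · refine ContinuousOn.intervalIntegrable ?_
    rw [uIcc_of_le hab]
    exact continuousOn_const.div (by fun_prop) fun x hx => by
      have : 0 < x := ha.trans_le hx.1
      positivity

lemma integral_div_self {a b c : ℝ} (ha : 0 < a) (hab : a ≤ b) :
    ∫ x in Ioo a b, c / x = c * (Real.log b - Real.log a) := by
  rw [← integral_Ioc_eq_integral_Ioo, ← intervalIntegral.integral_of_le hab]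
  have h := integral_inv_of_pos ha (ha.trans_le hab)
  simp only [div_eq_mul_inv]
  rw [intervalIntegral.integral_const_mul, h, Real.log_div (ha.trans_le hab).ne' ha.ne']

lemma integrableOn_div_pow {a b c : ℝ} (ha : 0 < a) (j : ℕ) :
    IntegrableOn (fun x => c / x ^ j) (Ioo a b) := by
  refine (ContinuousOn.integrableOn_Icc ?_).mono_set Ioo_subset_Icc_self
  exact continuousOn_const.div (by fun_prop) fun x hx => by
      have : 0 < x := ha.trans_le hx.1
      positivity

variable {a : ℝ}

lemma highLaw_univ (ha : a ∈ Ioo (0 : ℝ) 1) : highLaw a univ = 1 := by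
  rw [highLaw, Measure.add_apply, withDensity_apply _ MeasurableSet.univ, Measure.restrict_univ,
    ← ofReal_integral_eq_lintegral_ofReal (integrableOn_div_pow ha.1 2)
      (ae_of_all _ fun x => by have := ha.1; positivity), integral_div_sq ha.1 ha.2.le]
  simp only [Measure.smul_apply, measure_univ, smul_eq_mul, mul_one]
  rw [← ENNReal.ofReal_add _ ha.1.le]
  · have := ha.1.ne'
    rw [← ENNReal.ofReal_one]; congr 1; field_simp; ring
  · have h1 := ha.1
    have h2 : 1 ≤ 1 / a := by rw [le_div_iff₀ h1]; linarith [ha.2]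
    exact mul_nonneg h1.le (by linarith)

lemma isProbabilityMeasure_highLaw (ha : a ∈ Ioo (0 : ℝ) 1) :
    IsProbabilityMeasure (highLaw a) := ⟨highLaw_univ ha⟩

lemma ae_highLaw_of {P : ℝ → Prop} (h : ∀ᵐ x ∂(volume.restrict (Ioo a 1)), P x) (h1 : P 1) :
    ∀ᵐ x ∂(highLaw a), P x := by
  rw [highLaw, ae_add_measure_iff]
  refine ⟨(withDensity_absolutelyContinuous _ _).ae_le h, ?_⟩
  refine Measure.ae_smul_measure ?_ _
  rw [ae_dirac_eq]
  exact h1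

/-- The density is positive on `(a, 1)` and the atom has positive mass. Almost sure constraints
therefore hold exactly at the type `1`, which the single-buyer bound needs. -/
lemma ae_highLaw_iff (ha : a ∈ Ioo (0 : ℝ) 1) {P : ℝ → Prop} :
    (∀ᵐ x ∂(highLaw a), P x) ↔ (∀ᵐ x ∂(volume.restrict (Ioo a 1)), P x) ∧ P 1 := by
  refine ⟨fun h => ?_, fun h => ae_highLaw_of h.1 h.2⟩
  rw [highLaw, ae_add_measure_iff, ae_withDensity_iff (by fun_prop)] at h
  constructor
  · filter_upwards [h.1, ae_restrict_mem measurableSet_Ioo] with x hx hx2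
    refine hx ?_
    have h0 := ha.1
    have h1 : 0 < x := h0.trans hx2.1
    simp only [ne_eq, ENNReal.ofReal_eq_zero, not_le]
    positivity
  · have h2 := h.2
    have hne : ENNReal.ofReal a ≠ 0 := by simpa using ha.1
    rw [ae_iff, Measure.smul_apply, smul_eq_mul, mul_eq_zero, or_iff_right hne, ← ae_iff,
      ae_dirac_eq] at h2
    exact h2

lemma ae_highLaw_mem (ha : a ∈ Ioo (0 : ℝ) 1) : ∀ᵐ x ∂(highLaw a), x ∈ Ioc a 1 :=
  ae_highLaw_of (by filter_upwards [ae_restrict_mem measurableSet_Ioo] with x hx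
                      using Ioo_subset_Ioc_self hx) ⟨ha.2, le_rfl⟩

lemma integrable_highLaw_iff (ha : a ∈ Ioo (0 : ℝ) 1) {f : ℝ → ℝ} :
    Integrable f (highLaw a) ↔ IntegrableOn (fun x => a / x ^ 2 * f x) (Ioo a 1) := by
  rw [highLaw, integrable_add_measure, and_iff_left]
  · rw [integrable_withDensity_iff_integrable_smul' (by fun_prop)
      (ae_of_all _ fun x => ENNReal.ofReal_lt_top)]
    refine integrable_congr (ae_of_all _ fun x => ?_)
    have := ha.1
    simp only [smul_eq_mul]
    rw [ENNReal.toReal_ofReal (by positivity)]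
  · exact (integrable_dirac (by simp)).smul_measure (by simp)

lemma integral_highLaw (ha : a ∈ Ioo (0 : ℝ) 1) {f : ℝ → ℝ} (hf : Integrable f (highLaw a)) :
    ∫ x, f x ∂(highLaw a) = (∫ x in Ioo a 1, a / x ^ 2 * f x) + a * f 1 := by
  rw [highLaw, integrable_add_measure] at hf
  rw [highLaw, integral_add_measure hf.1 hf.2, integral_smul_measure, integral_dirac,
    integral_withDensity_eq_integral_toReal_smul (by fun_prop)
      (ae_of_all _ fun x => ENNReal.ofReal_lt_top)]
  have := ha.1
  simp only [smul_eq_mul]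
  rw [ENNReal.toReal_ofReal this.le]
  congr 2 with x
  rw [ENNReal.toReal_ofReal (by positivity)]

lemma integrable_id_highLaw (ha : a ∈ Ioo (0 : ℝ) 1) : Integrable (fun x => x) (highLaw a) := by
  have := isProbabilityMeasure_highLaw ha
  refine Integrable.of_bound (C := 1) measurable_id.aestronglyMeasurable ?_
  filter_upwards [ae_highLaw_mem ha] with x hx
  have := ha.1.trans hx.1
  rw [Real.norm_eq_abs, abs_of_pos this]
  exact hx.2

lemma integral_id_highLaw (ha : a ∈ Ioo (0 : ℝ) 1) :
    ∫ x, x ∂(highLaw a) = a - a * Real.log a := by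
  rw [integral_highLaw ha (integrable_id_highLaw ha)]
  have : ∫ x in Ioo a 1, a / x ^ 2 * x = ∫ x in Ioo a 1, a / x := by
    refine setIntegral_congr_fun measurableSet_Ioo fun x hx => ?_
    have : x ≠ 0 := (ha.1.trans hx.1).ne'
    field_simp
  rw [this, integral_div_self ha.1 ha.2.le, Real.log_one]
  ring

/-! ## The distribution `F*` -/

variable {n : ℕ} {m : Fin n → ℝ}

lemma measurable_activeProfile (i : Fin n) : Measurable (activeProfile m i) :=
  measurable_update _

@[simp] lemma activeProfile_self (i : Fin n) (x : ℝ) : activeProfile m i x i = x := by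
  simp [activeProfile]

lemma activeProfile_of_active {i j : Fin n} (hij : j ≠ i) (hj : j.val < cutoff m) (x : ℝ) :
    activeProfile m i x j = alpha m := by
  simp [activeProfile, hij, hj]

lemma activeProfile_of_inactive {i j : Fin n} (hi : i.val < cutoff m) (hj : ¬ j.val < cutoff m)
    (x : ℝ) : activeProfile m i x j = m j := by
  have hij : j ≠ i := by rintro rfl; exact hj hi
  simp [activeProfile, hij, hj]

lemma ae_worstCase_of {P : Values n → Prop} (hP : MeasurableSet {v | P v})
    (h : ∀ i : Fin n, i.val < cutoff m → ∀ᵐ x ∂(highLaw (alpha m)), P (activeProfile m i x)) :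
    ∀ᵐ v ∂(worstCase m), P v := by
  rw [worstCase, ae_finsetSum_measure_iff]
  refine fun i hi => Measure.ae_smul_measure ?_ _
  rw [ae_map_iff (measurable_activeProfile i).aemeasurable hP]
  exact h i (by simpa using hi)

/-- Since `θᵢ > 0`, the `i`-th component of the mixture is absolutely continuous with respect to
`F*`. In this direction `P` need not be measurable. -/
lemma ae_of_ae_worstCase (hn : 1 ≤ n) (hm : ∀ i, m i ∈ Ioo (0 : ℝ) 1) (hanti : Antitone m)
    {P : Values n → Prop} (h : ∀ᵐ v ∂(worstCase m), P v) {i : Fin n} (hi : i.val < cutoff m) :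
    ∀ᵐ x ∂(highLaw (alpha m)), P (activeProfile m i x) := by
  have h1 : (highLaw (alpha m)).map (activeProfile m i) ≪ worstCase m := by
    rw [worstCase]
    refine Measure.AbsolutelyContinuous.trans ?_ (Measure.absolutelyContinuous_of_le
      (Finset.single_le_sum (f := fun i => ENNReal.ofReal (theta m i) • (highLaw (alpha m)).map
        (activeProfile m i)) (fun _ _ => Measure.zero_le _) (Finset.mem_filter.2 ⟨Finset.mem_univ i, hi⟩)))
    refine Measure.absolutelyContinuous_smul ?_
    simpa using theta_pos hn hm hanti hi
  exact ae_of_ae_map (measurable_activeProfile i).aemeasurable (h1.ae_le h)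

lemma isProbabilityMeasure_worstCase (hn : 1 ≤ n) (hm : ∀ i, m i ∈ Ioo (0 : ℝ) 1)
    (hanti : Antitone m) : IsProbabilityMeasure (worstCase m) := by
  constructor
  have := isProbabilityMeasure_highLaw (alpha_spec hn hm hanti).1
  rw [worstCase, Measure.finsetSum_apply]
  have : ∀ i : Fin n, (ENNReal.ofReal (theta m i) • (highLaw (alpha m)).map (activeProfile m i)) univ
      = ENNReal.ofReal (theta m i) := fun i => by
    rw [Measure.smul_apply, Measure.map_apply (measurable_activeProfile i) MeasurableSet.univ,
      preimage_univ, measure_univ, smul_eq_mul, mul_one]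
  simp only [this]
  rw [← ENNReal.ofReal_sum_of_nonneg fun i hi => (theta_pos hn hm hanti (by simpa using hi)).le,
    sum_theta hn hm hanti, ENNReal.ofReal_one]

lemma integrable_worstCase_iff (hn : 1 ≤ n) (hm : ∀ i, m i ∈ Ioo (0 : ℝ) 1) (hanti : Antitone m)
    {f : Values n → ℝ} (hf : Measurable f) :
    Integrable f (worstCase m) ↔ ∀ i : Fin n, i.val < cutoff m →
      Integrable (fun x => f (activeProfile m i x)) (highLaw (alpha m)) := by
  rw [worstCase, integrable_finsetSum_measure]
  simp only [Finset.mem_filter, Finset.mem_univ, true_and]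
  refine forall₂_congr fun i hi => ?_
  rw [integrable_smul_measure (by simpa using theta_pos hn hm hanti hi) (by simp),
    integrable_map_measure hf.aestronglyMeasurable (measurable_activeProfile i).aemeasurable]
  rfl

lemma integral_worstCase (hn : 1 ≤ n) (hm : ∀ i, m i ∈ Ioo (0 : ℝ) 1) (hanti : Antitone m)
    {f : Values n → ℝ} (hf : Measurable f) (hint : Integrable f (worstCase m)) :
    ∫ v, f v ∂(worstCase m) = ∑ i : Fin n with i.val < cutoff m,
      theta m i * ∫ x, f (activeProfile m i x) ∂(highLaw (alpha m)) := by
  rw [worstCase] at hint ⊢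
  rw [integral_finsetSum_measure (integrable_finsetSum_measure.1 hint)]
  refine Finset.sum_congr rfl fun i hi => ?_
  rw [integral_smul_measure, integral_map (measurable_activeProfile i).aemeasurable
    hf.aestronglyMeasurable, ENNReal.toReal_ofReal (theta_pos hn hm hanti (by simpa using hi)).le,
    smul_eq_mul]

lemma ae_worstCase_eq_activeProfile (hn : 1 ≤ n) (hm : ∀ i, m i ∈ Ioo (0 : ℝ) 1)
    (hanti : Antitone m) : ∀ᵐ v ∂(worstCase m), ∃ i : Fin n, i.val < cutoff m ∧
      v i ∈ Ioc (alpha m) 1 ∧ v = activeProfile m i (v i) := by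
  refine ae_worstCase_of ?_ fun i hi => ?_
  · simp only [ofPred_exists]
    refine MeasurableSet.iUnion fun i => ?_
    refine (MeasurableSet.const _).inter (MeasurableSet.inter ?_ ?_)
    · exact measurableSet_Ioc.preimage (measurable_pi_apply i)
    · exact measurableSet_eq_fun measurable_id
        ((measurable_activeProfile i).comp (measurable_pi_apply i))
  · filter_upwards [ae_highLaw_mem (alpha_spec hn hm hanti).1] with x hx
    exact ⟨i, hi, by simpa using hx, by simp⟩

/-- `H` has mean `α - α ln α`, so an active bidder has mean `α + θᵢ (-α ln α)`, and `θᵢ` is chosen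
to make this `mᵢ`. -/
lemma isFeasible_worstCase (hn : 1 ≤ n) (hm : ∀ i, m i ∈ Ioo (0 : ℝ) 1) (hanti : Antitone m) :
    IsFeasible m (worstCase m) := by
  have ha := (alpha_spec hn hm hanti).1
  have hH := isProbabilityMeasure_highLaw ha
  have hF := isProbabilityMeasure_worstCase hn hm hanti
  have hV : ∀ᵐ v ∂(worstCase m), v ∈ Icc (0 : Values n) 1 := by
    filter_upwards [ae_worstCase_eq_activeProfile hn hm hanti] with v ⟨i, hi, hvi, hv⟩
    rw [← pi_univ_Icc, mem_univ_pi]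
    intro j
    rw [hv]
    by_cases hij : j = i
    · subst hij
      simpa using ⟨(ha.1.trans hvi.1).le, hvi.2⟩
    by_cases hj : j.val < cutoff m
    · rw [activeProfile_of_active hij hj]; exact Ioo_subset_Icc_self ha
    · rw [activeProfile_of_inactive hi hj]; exact Ioo_subset_Icc_self (hm j)
  refine ⟨hF, hV, fun j => ?_⟩
  rw [integral_worstCase hn hm hanti (measurable_pi_apply j)]
  · have key : ∀ i : Fin n, i.val < cutoff m → theta m i * ∫ x, activeProfile m i x j
        ∂(highLaw (alpha m)) = theta m i * (if j.val < cutoff m then alpha m else m j)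
          + if i = j then m j - alpha m else 0 := by
      intro i hi
      by_cases hij : i = j
      · subst hij
        simp only [activeProfile_self, integral_id_highLaw ha, hi, if_true]
        rw [← theta_mul hn hm hanti i]; ring
      by_cases hj : j.val < cutoff m
      · simp [activeProfile_of_active (Ne.symm hij) hj, hij, hj]
      · simp [activeProfile_of_inactive hi hj, hij, hj]
    rw [Finset.sum_congr rfl fun i hi => key i (by simpa using hi), Finset.sum_add_distrib,
      ← Finset.sum_mul, sum_theta hn hm hanti, Finset.sum_ite_eq']
    by_cases hj : j.val < cutoff m <;> simp [hj]
  · refine Integrable.of_bound (C := 1) (measurable_pi_apply j).aestronglyMeasurable ?_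
    filter_upwards [hV] with v hv
    rw [Real.norm_eq_abs, abs_of_nonneg (hv.1 j)]
    exact hv.2 j

/-! ## The random reserve price `G*` -/

lemma integral_reserve_density {a c : ℝ} (ha : a ∈ Ioo (0 : ℝ) 1) :
    ∫ p in Icc a 1, 1 / (p * c) = -Real.log a / c := by
  rw [integral_Icc_eq_integral_Ioo]
  have := integral_div_self (c := 1 / c) ha.1 ha.2.le
  rw [Real.log_one] at this
  rw [show -Real.log a / c = 1 / c * (0 - Real.log a) by ring, ← this]
  congr 1 with x
  rw [div_div, mul_comm]

lemma isProbabilityMeasure_optimalReserve (hn : 1 ≤ n) (hm : ∀ i, m i ∈ Ioo (0 : ℝ) 1)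
    (hanti : Antitone m) : IsProbabilityMeasure (optimalReserve m) := by
  have ha := (alpha_spec hn hm hanti).1
  have hc := normalizer_pos hn hm hanti
  have hk : (1 : ℝ) ≤ cutoff m := by exact_mod_cast (cutoff_mem hn hm hanti).1
  constructor
  rw [optimalReserve, Measure.add_apply, withDensity_apply _ MeasurableSet.univ,
    Measure.restrict_univ, ← ofReal_integral_eq_lintegral_ofReal, integral_reserve_density ha]
  · simp only [Measure.smul_apply, measure_univ, smul_eq_mul, mul_one]
    rw [← ENNReal.ofReal_add (div_nonneg (by linarith) hc.le)
      (div_nonneg (by linarith [Real.log_neg ha.1 ha.2]) hc.le), ← ENNReal.ofReal_one]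
    congr 1
    rw [← add_div, div_eq_one_iff_eq hc.ne']; ring
  · refine ContinuousOn.integrableOn_Icc ?_
    refine continuousOn_const.div (by fun_prop) fun x hx => ?_
    have := ha.1.trans_le hx.1
    positivity
  · filter_upwards [ae_restrict_mem measurableSet_Icc] with x hx
    have := ha.1.trans_le hx.1
    simp only [Pi.zero_apply]
    positivity

lemma ae_optimalReserve_of {P : ℝ → Prop} (h : ∀ᵐ x ∂(volume.restrict (Icc (alpha m) 1)), P x)
    (h0 : P 0) : ∀ᵐ x ∂(optimalReserve m), P x := by
  rw [optimalReserve, ae_add_measure_iff]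
  refine ⟨Measure.ae_smul_measure ?_ _, (withDensity_absolutelyContinuous _ _).ae_le h⟩
  rw [ae_dirac_eq]
  exact h0

lemma ae_optimalReserve_mem (ha : alpha m ∈ Ioo (0 : ℝ) 1) :
    ∀ᵐ r ∂(optimalReserve m), r ∈ Icc (0 : ℝ) 1 :=
  ae_optimalReserve_of (by filter_upwards [ae_restrict_mem measurableSet_Icc] with x hx
                              using ⟨ha.1.le.trans hx.1, hx.2⟩) ⟨le_rfl, zero_le_one⟩

/-- The only possible atom of `G*` is at `0`. This matters because the allocation of `S_G` counts
the reserves `r ≤ b` while the payment counts only `r < b`. -/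
lemma ae_optimalReserve_ne (b : ℝ) : ∀ᵐ r ∂(optimalReserve m), r = b → b = 0 := by
  refine ae_optimalReserve_of ?_ fun h => h.symm
  refine ae_restrict_of_ae ?_
  filter_upwards [Measure.ae_ne volume b] with r hr h using absurd h hr

lemma integral_optimalReserve (hn : 1 ≤ n) (hm : ∀ i, m i ∈ Ioo (0 : ℝ) 1) (hanti : Antitone m)
    {f : ℝ → ℝ} (hf : Integrable f (optimalReserve m)) :
    ∫ r, f r ∂(optimalReserve m) = ((cutoff m - 1) * f 0 + ∫ p in Icc (alpha m) 1, f p / p)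
      / ((cutoff m : ℝ) - 1 - Real.log (alpha m)) := by
  have ha := (alpha_spec hn hm hanti).1
  have hc := normalizer_pos hn hm hanti
  have hk : (1 : ℝ) ≤ cutoff m := by exact_mod_cast (cutoff_mem hn hm hanti).1
  rw [optimalReserve, integrable_add_measure] at hf
  rw [optimalReserve, integral_add_measure hf.1 hf.2, integral_smul_measure, integral_dirac,
    integral_withDensity_eq_integral_toReal_smul (by fun_prop)
      (ae_of_all _ fun x => ENNReal.ofReal_lt_top), add_div, ← integral_div]
  congr 1
  · rw [ENNReal.toReal_ofReal (div_nonneg (by linarith) hc.le), smul_eq_mul]; ring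
  · refine setIntegral_congr_fun measurableSet_Icc fun x hx => ?_
    have := ha.1.trans_le hx.1
    simp only [smul_eq_mul]
    rw [ENNReal.toReal_ofReal (by positivity)]
    field_simp

end

section

/-! ## Order statistics and shares -/

variable {n : ℕ} {m : Fin n → ℝ}

lemma le_highest (v : Values n) (i : Fin n) : v i ≤ highest v :=
  le_ciSup (Set.finite_range v).bddAbove i

lemma exists_eq_highest (hn : 1 ≤ n) (v : Values n) : ∃ i, v i = highest v := by
  have : Nonempty (Fin n) := ⟨⟨0, hn⟩⟩
  exact exists_eq_ciSup_of_finite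

lemma min_le_secondHighest (v : Values n) {i j : Fin n} (hij : i ≠ j) :
    min (v i) (v j) ≤ secondHighest v :=
  le_ciSup (f := fun p : {p : Fin n × Fin n // p.1 ≠ p.2} => min (v p.1.1) (v p.1.2))
    (Set.finite_range _).bddAbove ⟨(i, j), hij⟩

lemma secondHighest_le (hn : 2 ≤ n) {v : Values n} {i : Fin n} {y : ℝ}
    (h : ∀ j, j ≠ i → v j ≤ y) : secondHighest v ≤ y := by
  have : Nonempty {p : Fin n × Fin n // p.1 ≠ p.2} :=
    ⟨⟨(⟨0, by omega⟩, ⟨1, by omega⟩), by simp⟩⟩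
  refine ciSup_le fun ⟨p, hp⟩ => ?_
  by_cases h1 : p.1 = i
  · exact (min_le_right _ _).trans (h _ fun h2 => hp (h1.trans h2.symm))
  · exact (min_le_left _ _).trans (h _ h1)

lemma highest_mem (hn : 1 ≤ n) {v : Values n} (hv : v ∈ Icc (0 : Values n) 1) :
    highest v ∈ Icc (0 : ℝ) 1 := by
  obtain ⟨i, hi⟩ := exists_eq_highest hn v
  rw [← hi]
  exact ⟨hv.1 i, hv.2 i⟩

lemma secondHighest_mem (hn : 2 ≤ n) {v : Values n} (hv : v ∈ Icc (0 : Values n) 1) :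
    secondHighest v ∈ Icc (0 : ℝ) 1 := by
  constructor
  · have : (⟨0, by omega⟩ : Fin n) ≠ ⟨1, by omega⟩ := by simp
    exact le_trans (le_min (hv.1 _) (hv.1 _)) (min_le_secondHighest v this)
  · exact secondHighest_le hn (i := ⟨0, by omega⟩) fun j _ => hv.2 j

lemma measurable_highest : Measurable (highest : Values n → ℝ) :=
  Measurable.iSup fun i => measurable_pi_apply i

lemma measurable_secondHighest : Measurable (secondHighest : Values n → ℝ) :=
  Measurable.iSup fun p => (measurable_pi_apply p.1.1).min (measurable_pi_apply p.1.2)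

lemma winShare_mem (i : Fin n) (v : Values n) : winShare i v ∈ Icc (0 : ℝ) 1 := by
  rw [winShare]
  split_ifs with h
  · refine ⟨by positivity, ?_⟩
    refine div_le_one_of_le₀ ?_ (by positivity)
    exact_mod_cast Finset.card_pos.2 ⟨i, by simpa using h⟩
  · simp

lemma winShare_of_ne {i : Fin n} {v : Values n} (h : v i ≠ highest v) : winShare i v = 0 := by
  rw [winShare, if_neg h]

lemma winShare_eq_one {i : Fin n} {v : Values n} (h : v i = highest v)
    (hj : ∀ j, j ≠ i → v j ≠ highest v) : winShare i v = 1 := by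
  classical
  rw [winShare, if_pos h]
  have : (Finset.univ.filter fun j => v j = highest v) = {i} := by
    ext j
    simp only [Finset.mem_filter, Finset.mem_univ, true_and, Finset.mem_singleton]
    exact ⟨fun h => by_contra fun h2 => hj j h2 h, fun h2 => h2 ▸ h⟩
  simp only [one_div]
  rw [inv_eq_one, Nat.cast_eq_one]
  convert Finset.card_singleton i

lemma sum_winShare (hn : 1 ≤ n) (v : Values n) : ∑ i, winShare i v = 1 := by
  classical
  obtain ⟨i, hi⟩ := exists_eq_highest hn v
  simp only [winShare]
  rw [← Finset.sum_filter, Finset.sum_const, nsmul_eq_mul]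
  have : 0 < (Finset.univ.filter fun j => v j = highest v).card :=
    Finset.card_pos.2 ⟨i, by simpa using hi⟩
  rw [mul_one_div]
  convert div_self (a := ((Finset.univ.filter fun j => v j = highest v).card : ℝ)) (by positivity)

lemma measurable_winShare (i : Fin n) : Measurable (winShare (n := n) i) := by
  classical
  have hS : ∀ j : Fin n, MeasurableSet {v : Values n | v j = highest v} := fun j =>
    measurableSet_eq_fun (measurable_pi_apply j) measurable_highest
  have hc : Measurable fun v : Values n => ∑ j, if v j = highest v then (1 : ℝ) else 0 :=
    Finset.measurable_fun_sum _ fun j _ => Measurable.ite (hS j) measurable_const measurable_const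
  have : winShare (n := n) i = fun v : Values n => if v i = highest v then
      1 / (∑ j, if v j = highest v then (1 : ℝ) else 0) else 0 := by
    ext v
    rw [winShare]
    congr 2
    rw [Finset.sum_boole]
  rw [this]
  exact Measurable.ite (hS i) (measurable_const.div hc) measurable_const

/-- The highest value among the competitors of bidder `i`. -/
noncomputable def rivalMax (i : Fin n) (v : Values n) : ℝ := ⨆ j : {j : Fin n // j ≠ i}, v j

lemma le_rivalMax {i j : Fin n} (hj : j ≠ i) (v : Values n) : v j ≤ rivalMax i v :=
  le_ciSup (f := fun j : {j : Fin n // j ≠ i} => v j) (Set.finite_range _).bddAbove ⟨j, hj⟩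

lemma exists_eq_rivalMax (hn : 2 ≤ n) (i : Fin n) (v : Values n) :
    ∃ j, j ≠ i ∧ v j = rivalMax i v := by
  have : Nontrivial (Fin n) := Fin.nontrivial_iff_two_le.2 hn
  obtain ⟨j, hj⟩ := exists_ne i
  have : Nonempty {j : Fin n // j ≠ i} := ⟨⟨j, hj⟩⟩
  obtain ⟨⟨j, hj⟩, h⟩ := exists_eq_ciSup_of_finite (f := fun j : {j : Fin n // j ≠ i} => v j)
  exact ⟨j, hj, h⟩

lemma rivalMax_update (i : Fin n) (v : Values n) (b : ℝ) :
    rivalMax i (Function.update v i b) = rivalMax i v := by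
  unfold rivalMax
  congr 1 with j
  rw [Function.update_of_ne j.2]

lemma secondHighest_eq_rivalMax (hn : 2 ≤ n) {i : Fin n} {v : Values n} (h : v i = highest v) :
    secondHighest v = rivalMax i v := by
  refine le_antisymm (secondHighest_le hn fun j hj => le_rivalMax hj v) ?_
  obtain ⟨j, hj, hj2⟩ := exists_eq_rivalMax hn i v
  rw [← hj2, ← min_eq_right (h ▸ le_highest v j : v j ≤ v i)]
  exact min_le_secondHighest v hj.symm

/-! ## Payments -/

/-- The expected payment of the winner of the second-price auction. -/
noncomputable def winnerPayment (G : Measure ℝ) (v : Values n) : ℝ :=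
  ∫ r, if r < highest v then max (secondHighest v) r else 0 ∂G

variable {G : Measure ℝ}

lemma measurable_winnerPayment [IsProbabilityMeasure G] : Measurable (winnerPayment (n := n) G) := by
  have : Measurable fun p : Values n × ℝ =>
      if p.2 < highest p.1 then max (secondHighest p.1) p.2 else 0 := by
    refine Measurable.ite ?_ ?_ measurable_const
    · exact measurableSet_lt measurable_snd (measurable_highest.comp measurable_fst)
    · exact (measurable_secondHighest.comp measurable_fst).max measurable_snd
  exact (this.stronglyMeasurable.integral_prod_right (ν := G)).measurable

lemma measurable_price (v : Values n) :
    Measurable fun r => if r < highest v then max (secondHighest v) r else 0 :=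
  Measurable.ite measurableSet_Iio (measurable_const.max measurable_id) measurable_const

lemma abs_price_le (hn : 2 ≤ n) {v : Values n} (hv : v ∈ Icc (0 : Values n) 1) {r : ℝ}
    (hr : r ∈ Icc (0 : ℝ) 1) :
    ‖if r < highest v then max (secondHighest v) r else 0‖ ≤ 1 := by
  have h := secondHighest_mem hn hv
  split_ifs
  · rw [Real.norm_eq_abs, abs_of_nonneg (hr.1.trans (le_max_right _ _))]
    exact max_le h.2 hr.2
  · simp

lemma integrable_price [IsProbabilityMeasure G] (hn : 2 ≤ n) (hG : ∀ᵐ r ∂G, r ∈ Icc (0 : ℝ) 1) {v : Values n}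
    (hv : v ∈ Icc (0 : Values n) 1) :
    Integrable (fun r => if r < highest v then max (secondHighest v) r else 0) G := by
  refine Integrable.of_bound (C := 1) (measurable_price v).aestronglyMeasurable ?_
  filter_upwards [hG] with r hr using abs_price_le hn hv hr

lemma abs_winnerPayment_le [IsProbabilityMeasure G] (hn : 2 ≤ n) (hG : ∀ᵐ r ∂G, r ∈ Icc (0 : ℝ) 1) {v : Values n}
    (hv : v ∈ Icc (0 : Values n) 1) : ‖winnerPayment G v‖ ≤ 1 := by
  refine (norm_integral_le_of_norm_le_const (C := 1) ?_).trans (by simp)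
  filter_upwards [hG] with r hr using abs_price_le hn hv hr

/-! ## Ex-post incentive compatibility -/

/-- The ex-post payoff of a bidder `i` with value `τ` when the profile `v` is reported. -/
noncomputable def expostPayoff (G : Measure ℝ) (i : Fin n) (τ : ℝ) (v : Values n) : ℝ :=
  τ * (G.real (Iic (v i)) * winShare i v) - winnerPayment G v * winShare i v

lemma measurable_expostPayoff [IsProbabilityMeasure G] (i : Fin n) (τ : ℝ) : Measurable (expostPayoff G i τ) := by
  have h : Measurable fun v : Values n => G.real (Iic (v i)) := by
    have : Monotone fun b : ℝ => G.real (Iic b) := fun b c hbc =>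
      measureReal_mono (Iic_subset_Iic.2 hbc)
    exact this.measurable.comp (measurable_pi_apply i)
  exact ((h.mul (measurable_winShare i)).const_mul τ).sub
    (measurable_winnerPayment.mul (measurable_winShare i))

lemma abs_expostPayoff_le [IsProbabilityMeasure G] (hn : 2 ≤ n) (hG : ∀ᵐ r ∂G, r ∈ Icc (0 : ℝ) 1) (i : Fin n) {τ : ℝ}
    (hτ : τ ∈ Icc (0 : ℝ) 1) {v : Values n} (hv : v ∈ Icc (0 : Values n) 1) :
    ‖expostPayoff G i τ v‖ ≤ 2 := by
  have h1 := abs_winnerPayment_le hn hG hv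
  have h2 := winShare_mem i v
  have h3 : G.real (Iic (v i)) ≤ 1 := measureReal_le_one
  have h4 : 0 ≤ G.real (Iic (v i)) := measureReal_nonneg
  have h5 : ‖τ * (G.real (Iic (v i)) * winShare i v)‖ ≤ 1 := by
    rw [Real.norm_eq_abs, abs_of_nonneg (mul_nonneg hτ.1 (mul_nonneg h4 h2.1))]
    exact mul_le_one₀ hτ.2 (mul_nonneg h4 h2.1) (mul_le_one₀ h3 h2.1 h2.2)
  have h6 : ‖winnerPayment G v * winShare i v‖ ≤ 1 := by
    rw [norm_mul, Real.norm_eq_abs (winShare i v), abs_of_nonneg h2.1]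
    exact mul_le_one₀ h1 h2.1 h2.2
  exact (norm_sub_le _ _).trans (by linarith)

/-- The payoff from bidding one's value `τ` against rival bids with maximum `y`. -/
noncomputable def truthfulPayoff (G : Measure ℝ) (τ y : ℝ) : ℝ := ∫ r, max (τ - max y r) 0 ∂G

lemma truthfulPayoff_nonneg (τ y : ℝ) : 0 ≤ truthfulPayoff G τ y :=
  integral_nonneg fun _ => le_max_right _ _

lemma integrable_truthful [IsProbabilityMeasure G] (hG : ∀ᵐ r ∂G, r ∈ Icc (0 : ℝ) 1) {τ y : ℝ} (hτ : τ ∈ Icc (0 : ℝ) 1) :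
    Integrable (fun r => max (τ - max y r) 0) G := by
  refine Integrable.of_bound (C := 1) (by fun_prop) ?_
  filter_upwards [hG] with r hr
  rw [Real.norm_eq_abs, abs_of_nonneg (le_max_right _ _)]
  refine max_le ?_ zero_le_one
  linarith [le_max_right y r, hτ.2, hr.1]

/-- Writes a top bidder's payoff as an average over the reserve, so that reports can be compared
reserve by reserve. -/
lemma expostPayoff_of_win [IsProbabilityMeasure G] (hn : 2 ≤ n) (hG : ∀ᵐ r ∂G, r ∈ Icc (0 : ℝ) 1) {i : Fin n} (τ : ℝ)
    {v : Values n} (hv : v ∈ Icc (0 : Values n) 1) (h : v i = highest v) :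
    Integrable (fun r => (if r ≤ v i then τ else 0) -
      (if r < v i then max (rivalMax i v) r else 0)) G ∧
    expostPayoff G i τ v = (∫ r, ((if r ≤ v i then τ else 0) -
      (if r < v i then max (rivalMax i v) r else 0)) ∂G) * winShare i v := by
  have h1 := integrable_price hn hG hv
  have h2 : (fun r => if r ≤ v i then τ else 0) = (Iic (v i)).indicator fun _ => τ := by
    ext r; simp [indicator]
  have h3 : Integrable (fun r => if r ≤ v i then τ else 0) G := by
    rw [h2]; exact (integrable_const τ).indicator measurableSet_Iic
  rw [← secondHighest_eq_rivalMax hn h]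
  rw [← h] at h1
  refine ⟨h3.sub h1, ?_⟩
  rw [integral_sub h3 h1, h2, integral_indicator measurableSet_Iic, setIntegral_const,
    expostPayoff, winnerPayment, ← h, smul_eq_mul]
  ring

/-- For each reserve, winning at the price `max y r` is worth at most the positive part of `τ - max
y r`; sharing a tie only scales down a bound that is nonnegative. -/
lemma expostPayoff_le [IsProbabilityMeasure G] (hn : 2 ≤ n) (hG : ∀ᵐ r ∂G, r ∈ Icc (0 : ℝ) 1)
    (hatom : ∀ b, ∀ᵐ r ∂G, r = b → b = 0) {i : Fin n} {τ : ℝ}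
    (hτ : τ ∈ Icc (0 : ℝ) 1) {v : Values n} (hv : v ∈ Icc (0 : Values n) 1) :
    expostPayoff G i τ v ≤ truthfulPayoff G τ (rivalMax i v) := by
  by_cases h : v i = highest v
  · obtain ⟨hint, heq⟩ := expostPayoff_of_win hn hG τ hv h
    obtain ⟨j, hj, hjy⟩ := exists_eq_rivalMax hn i v
    have hyb : rivalMax i v ≤ v i := by rw [← hjy, h]; exact le_highest v j
    have hle : ∫ r, ((if r ≤ v i then τ else 0) -
        (if r < v i then max (rivalMax i v) r else 0)) ∂G
        ≤ truthfulPayoff G τ (rivalMax i v) := by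
      refine integral_mono_ae hint (integrable_truthful hG hτ) ?_
      filter_upwards [hG, hatom (v i)] with r hr hb
      rcases lt_trichotomy r (v i) with h1 | h1 | h1
      · simp [h1, h1.le]
      -- A bid equal to the reserve occurs with positive probability only at `0`. The good is then
      -- free, and the payoff `τ` is still `τ - max y r`.
      · have hb0 := hb h1
        rw [hb0] at hyb h1
        subst h1
        simp only [hb0, le_refl, if_true, lt_irrefl, if_false, sub_zero]
        refine le_max_of_le_left ?_
        rw [max_eq_right hyb, sub_zero]
      · simp [not_le.2 h1, not_lt.2 h1.le]
    rw [heq]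
    have hw := winShare_mem i v
    exact (mul_le_mul_of_nonneg_right hle hw.1).trans
      (mul_le_of_le_one_right (truthfulPayoff_nonneg _ _) hw.2)
  · rw [expostPayoff, winShare_of_ne h]
    simpa using truthfulPayoff_nonneg τ (rivalMax i v)

/-- A truthful bidder who is not strictly highest has zero payoff on both sides, so the tie-breaking
share is immaterial; a strict winner has share `1`. -/
lemma expostPayoff_self [IsProbabilityMeasure G] (hn : 2 ≤ n) (hG : ∀ᵐ r ∂G, r ∈ Icc (0 : ℝ) 1)
    (hatom : ∀ b, ∀ᵐ r ∂G, r = b → b = 0) {i : Fin n}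
    {v : Values n} (hv : v ∈ Icc (0 : Values n) 1) :
    expostPayoff G i (v i) v = truthfulPayoff G (v i) (rivalMax i v) := by
  have hzero : v i ≤ rivalMax i v → truthfulPayoff G (v i) (rivalMax i v) = 0 := by
    intro h
    rw [truthfulPayoff]
    refine integral_eq_zero_of_ae (ae_of_all _ fun r => ?_)
    exact max_eq_right (by linarith [le_max_left (rivalMax i v) r])
  by_cases h : v i = highest v
  · obtain ⟨hint, heq⟩ := expostPayoff_of_win hn hG (v i) hv h
    obtain ⟨j, hj, hjy⟩ := exists_eq_rivalMax hn i v
    have hyb : rivalMax i v ≤ v i := by rw [← hjy, h]; exact le_highest v j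
    have hle : ∫ r, ((if r ≤ v i then v i else 0) -
        (if r < v i then max (rivalMax i v) r else 0)) ∂G
        = truthfulPayoff G (v i) (rivalMax i v) := by
      refine integral_congr_ae ?_
      filter_upwards [hG, hatom (v i)] with r hr hb
      rcases lt_trichotomy r (v i) with h1 | h1 | h1
      · simp only [h1.le, h1, if_true]
        rw [max_eq_left (a := v i - _) (by linarith [max_le hyb h1.le])]
      · have hb0 := hb h1
        rw [hb0] at h1
        subst h1
        simp [hb0]
      · simp only [not_le.2 h1, not_lt.2 h1.le, if_false, sub_zero]
        rw [max_eq_right]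
        linarith [le_max_right (rivalMax i v) r]
    rw [heq, hle]
    by_cases ht : ∃ j, j ≠ i ∧ v j = highest v
    · obtain ⟨j, hj, hjh⟩ := ht
      rw [hzero, zero_mul]
      rw [h, ← hjh]; exact le_rivalMax hj v
    · push Not at ht
      rw [winShare_eq_one h ht, mul_one]
  · rw [expostPayoff, winShare_of_ne h, hzero]
    · simp
    · obtain ⟨j, hj⟩ := exists_eq_highest (by omega) v
      have hji : j ≠ i := fun h2 => h (h2 ▸ hj)
      exact (le_highest v i).trans (hj ▸ le_rivalMax hji v)

/-! ## Competitiveness of second-price auctions -/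

lemma ae_law_of_ae {F : Measure (Values n)} [IsProbabilityMeasure F] (I : InfoStructure n)
    {P : Values n → Prop} (h : ∀ᵐ v ∂F, P v) : ∀ᵐ ω ∂(law F I), P ω.1 := by
  have hfst : (law F I).map Prod.fst = F := Measure.fst_compProd F I.κ
  rw [← hfst] at h
  exact ae_of_ae_map measurable_fst.aemeasurable h

lemma measurable_ownType (I : InfoStructure n) (i : Fin n) : Measurable (I.ownType i) :=
  ((measurable_pi_apply i).comp measurable_fst).prodMk ((measurable_pi_apply i).comp measurable_snd)

/-- Disintegration of the joint law of `(X ω, ω)`. It is used to see that conditional laws live on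
`V`, are consistent with the type, and pin down the profile for high types under `F*`. -/
lemma ae_ae_condDistrib {Ω β : Type*} [MeasurableSpace Ω] [StandardBorelSpace Ω] [Nonempty Ω]
    [MeasurableSpace β] {μ : Measure Ω} [IsFiniteMeasure μ] {X : Ω → β} (hX : Measurable X)
    {P : β → Ω → Prop} (hP : MeasurableSet {p : β × Ω | P p.1 p.2}) (h : ∀ᵐ ω ∂μ, P (X ω) ω) :
    ∀ᵐ τ ∂(μ.map X), ∀ᵐ ω ∂(condDistrib id X μ τ), P τ ω := by
  refine Measure.ae_ae_of_ae_compProd (p := fun p : β × Ω => P p.1 p.2) ?_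
  rw [compProd_map_condDistrib aemeasurable_id, ae_map_iff (by fun_prop) hP]
  exact h

lemma update_mem {v : Values n} (hv : v ∈ Icc (0 : Values n) 1) (i : Fin n) {b : ℝ}
    (hb : b ∈ Icc (0 : ℝ) 1) : Function.update v i b ∈ Icc (0 : Values n) 1 := by
  rw [← pi_univ_Icc, mem_univ_pi] at hv ⊢
  intro j
  by_cases hj : j = i
  · subst hj; simpa using hb
  · rw [Function.update_of_ne hj]; exact hv j

lemma interimUtility_secondPrice (F : Feasible m) (I : InfoStructure n) (i : Fin n)
    (r τ : I.OwnType i) :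
    ((secondPrice G : Mechanism m) F I).interimUtility F.1 i r τ
      = ∫ ω, expostPayoff G i τ.1 (Function.update ω.1 i r.1)
        ∂(condDistrib id (I.ownType i) (law F.1 I) τ) := rfl

lemma ae_type_mem (F : Feasible m) (I : InfoStructure n) (i : Fin n) :
    ∀ᵐ τ ∂((law F.1 I).map (I.ownType i)), τ.1 ∈ Icc (0 : ℝ) 1 ∧
      ∀ᵐ ω ∂(condDistrib id (I.ownType i) (law F.1 I) τ), ω.1 ∈ Icc (0 : Values n) 1 := by
  refine Filter.Eventually.and ?_ ?_
  · rw [ae_map_iff (measurable_ownType I i).aemeasurable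
      (measurableSet_Icc.preimage measurable_fst)]
    filter_upwards [ae_law_of_ae I F.2.ae_mem] with ω hω using ⟨hω.1 i, hω.2 i⟩
  · exact ae_ae_condDistrib (P := fun _ ω => ω.1 ∈ Icc (0 : Values n) 1) (measurable_ownType I i)
      (measurableSet_Icc.preimage (measurable_fst.comp measurable_snd))
      (ae_law_of_ae I F.2.ae_mem)

/-- Truth-telling is optimal against every rival profile in `V`, so integrating the pointwise
inequality over any conditional law gives IR and IC, whatever the beliefs. -/
lemma isCompetitive_secondPrice [IsProbabilityMeasure G] (hn : 2 ≤ n) (hG : ∀ᵐ r ∂G, r ∈ Icc (0 : ℝ) 1)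
    (hatom : ∀ b, ∀ᵐ r ∂G, r = b → b = 0) (F : Feasible m) (I : InfoStructure n) :
    ((secondPrice G : Mechanism m) F I).IsCompetitive F := by
  have htruth : ∀ (i : Fin n) (v : Values n) (τ : ℝ), v ∈ Icc (0 : Values n) 1 →
      τ ∈ Icc (0 : ℝ) 1 → expostPayoff G i τ (Function.update v i τ)
        = truthfulPayoff G τ (rivalMax i v) := by
    intro i v τ hv hτ
    have := expostPayoff_self hn hG hatom (i := i) (update_mem hv i hτ)
    simpa only [Function.update_self, rivalMax_update] using this
  refine ⟨⟨fun i => ?_, fun i => ?_, fun i ω _ => ?_, fun i => ?_⟩, fun i => ?_, fun i => ?_,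
    fun i => ?_⟩
  · have : Monotone fun b : ℝ => G.real (Iic b) := fun b c hbc =>
      measureReal_mono (Iic_subset_Iic.2 hbc)
    exact (this.measurable.comp ((measurable_pi_apply i).comp measurable_fst)).mul
      ((measurable_winShare i).comp measurable_fst)
  · exact (measurable_winnerPayment.comp measurable_fst).mul
      ((measurable_winShare i).comp measurable_fst)
  · have hw := winShare_mem i ω.1
    exact ⟨mul_nonneg measureReal_nonneg hw.1, mul_le_one₀ measureReal_le_one hw.1 hw.2⟩
  · refine Integrable.of_bound (C := 1) ((measurable_winnerPayment.comp measurable_fst).mul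
      ((measurable_winShare i).comp measurable_fst)).aestronglyMeasurable ?_
    filter_upwards [ae_law_of_ae I F.2.ae_mem] with ω hω
    have hw := winShare_mem i ω.1
    change ‖winnerPayment G ω.1 * winShare i ω.1‖ ≤ 1
    rw [norm_mul, Real.norm_eq_abs (winShare i ω.1), abs_of_nonneg hw.1]
    exact mul_le_one₀ (abs_winnerPayment_le hn hG hω) hw.1 hw.2
  · filter_upwards [ae_type_mem F I i] with τ ⟨hτ, hω⟩
    rw [interimUtility_secondPrice]
    refine integral_nonneg_of_ae ?_
    filter_upwards [hω] with ω hω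
    rw [htruth i ω.1 τ.1 hω hτ]
    exact truthfulPayoff_nonneg _ _
  · filter_upwards [ae_type_mem F I i] with τ ⟨hτ, hω⟩ r hr
    rw [interimUtility_secondPrice, interimUtility_secondPrice]
    have hint : ∀ b ∈ Icc (0 : ℝ) 1, Integrable (fun ω : I.Profile =>
        expostPayoff G i τ.1 (Function.update ω.1 i b))
        (condDistrib id (I.ownType i) (law F.1 I) τ) := fun b hb => by
      refine Integrable.of_bound (C := 2) ((measurable_expostPayoff i τ.1).comp
        (measurable_update_left.comp measurable_fst)).aestronglyMeasurable ?_
      filter_upwards [hω] with ω hω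
      exact abs_expostPayoff_le hn hG i hτ (update_mem hω i hb)
    refine integral_mono_ae (hint _ hr) (hint _ hτ) ?_
    filter_upwards [hω] with ω hω
    rw [htruth i ω.1 τ.1 hω hτ, ← rivalMax_update i ω.1 r.1]
    exact expostPayoff_le hn hG hatom hτ (update_mem hω i hr)
  · by_cases hex : ∃ a, NonCompetitive F.1 i a
    · obtain ⟨a, ha⟩ := hex
      -- A support has at most one minimum, so only one value, hence one null set, has to be
      -- handled.
      have huniq : ∀ b, NonCompetitive F.1 i b → b = a := fun b hb => hb.1.unique ha.1
      have hae : ∀ᵐ v ∂F.1, v i = a → ∃ j, a < v j := by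
        have hm : MeasurableSet {v : Values n | v i = a} :=
          (measurableSet_singleton a).preimage (measurable_pi_apply i)
        have hm2 : MeasurableSet {v : Values n | ∃ j, a < v j} := by
          rw [ofPred_exists]
          exact MeasurableSet.iUnion fun j => measurableSet_Ioi.preimage (measurable_pi_apply j)
        have h1 := ha.2
        -- Conditioning on a null event gives the zero measure, so a conditional probability `1`
        -- forces positive mass.
        have hne : F.1 {v : Values n | v i = a} ≠ 0 := by
          intro h0
          rw [cond_eq_zero_of_meas_eq_zero h0] at h1
          simp at h1
        have := cond_isProbabilityMeasure hne
        have h2 : ∀ᵐ v ∂(F.1[|{v : Values n | v i = a}]), ∃ j, a < v j := by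
          rw [ae_iff, ← compl_ofPred, prob_compl_eq_zero_iff hm2]
          exact h1
        rw [ProbabilityTheory.cond] at h2
        refine (ae_restrict_iff' hm).1 ?_
        exact (Measure.ae_ennreal_smul_measure_iff (c := (F.1 {v : Values n | v i = a})⁻¹)
          (by simp)).1 h2
      filter_upwards [ae_law_of_ae I hae] with ω hω hnc
      obtain ⟨j, hj⟩ := hω (huniq _ hnc)
      rw [← huniq _ hnc] at hj
      change G.real (Iic (ω.1 i)) * winShare i ω.1 = 0
      rw [winShare_of_ne (hj.trans_le (le_highest _ _)).ne, mul_zero]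
    · push Not at hex
      exact ae_of_all _ fun ω h => absurd h (hex _)

lemma sum_secondPrice_x_le [IsProbabilityMeasure G] (hn : 1 ≤ n) (F : Feasible m) (I : InfoStructure n) (ω : I.Profile) :
    ∑ i, ((secondPrice G : Mechanism m) F I).x i ω ≤ 1 := by
  rw [← sum_winShare hn ω.1]
  refine Finset.sum_le_sum fun i _ => ?_
  exact mul_le_of_le_one_left (winShare_mem i _).1 measureReal_le_one

end

section

/-! ## Revenue of the second-price auction with reserve `G*` -/

variable {n : ℕ} {m : Fin n → ℝ}

lemma revenue_secondPrice {G : Measure ℝ} [IsProbabilityMeasure G] (hn : 2 ≤ n)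
    (hG : ∀ᵐ r ∂G, r ∈ Icc (0 : ℝ) 1) (hatom : ∀ b, ∀ᵐ r ∂G, r = b → b = 0)
    (F : Feasible m) (I : InfoStructure n) :
    Mechanism.revenue F I (secondPrice G) = ∫ v, winnerPayment G v ∂F.1 := by
  have hfst : (law F.1 I).map Prod.fst = F.1 := Measure.fst_compProd F.1 I.κ
  rw [← hfst, integral_map measurable_fst.aemeasurable
    measurable_winnerPayment.aestronglyMeasurable]
  have hreg := (isCompetitive_secondPrice hn hG hatom F I).regular.integrable_t
  rw [Mechanism.revenue, DirectMechanism.revenue, ← integral_finsetSum _ fun i _ => hreg i]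
  congr 1 with ω
  change ∑ i, winnerPayment G ω.1 * winShare i ω.1 = _
  rw [← Finset.mul_sum, sum_winShare (by omega), mul_one]

/-! ### The winner's payment under `G*` and its affine minorant -/

lemma integral_indicator_reserve {a b : ℝ} (hb : b ≤ 1) :
    ∫ p in Icc a 1, (if p < b then (1 : ℝ) else 0) = max (b - a) 0 := by
  have h1 : (fun p => if p < b then (1 : ℝ) else 0) = (Iio b).indicator fun _ => 1 := by
    ext p; simp [indicator]
  rw [h1, setIntegral_indicator measurableSet_Iio, setIntegral_const, smul_eq_mul, mul_one]
  have h2 : Icc a 1 ∩ Iio b = Ico a b := by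
    ext p
    simp only [mem_inter_iff, mem_Icc, mem_Iio, mem_Ico]
    exact ⟨fun h => ⟨h.1.1, h.2⟩, fun h => ⟨⟨h.1, h.2.le.trans hb⟩, h.2⟩⟩
  rw [h2, Measure.real, Real.volume_Ico, ENNReal.toReal_ofReal']

lemma secondHighest_le_highest (hn : 2 ≤ n) (v : Values n) : secondHighest v ≤ highest v :=
  secondHighest_le hn (i := ⟨0, by omega⟩) fun j _ => le_highest v j

lemma winnerPayment_optimalReserve (hn : 2 ≤ n) (hm : ∀ i, m i ∈ Ioo (0 : ℝ) 1)
    (hanti : Antitone m) {v : Values n} (hv : v ∈ Icc (0 : Values n) 1) :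
    winnerPayment (optimalReserve m) v = ((cutoff m - 1) * secondHighest v +
      ∫ p in Icc (alpha m) 1, (if p < highest v then max (secondHighest v) p else 0) / p)
        / ((cutoff m : ℝ) - 1 - Real.log (alpha m)) := by
  have ha := (alpha_spec (by omega) hm hanti).1
  have := isProbabilityMeasure_optimalReserve (by omega) hm hanti
  have hs := secondHighest_mem hn hv
  rw [winnerPayment, integral_optimalReserve (by omega) hm hanti
    (integrable_price hn (ae_optimalReserve_mem ha) hv)]
  congr 3
  -- The integrand at the atom `r = 0` equals `v⁽²⁾` in both cases: when `v⁽¹⁾` is not positive,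
  -- `v⁽²⁾` is `0` too.
  split_ifs with h
  · exact max_eq_left hs.1
  · exact le_antisymm hs.1 ((secondHighest_le_highest hn v).trans (not_lt.1 h))

/-- One bidder has the highest value and all others are at most `v⁽²⁾`. If that bidder is inactive,
the bound `k v⁽²⁾` is even smaller. -/
lemma sum_active_le (hn : 2 ≤ n) (hm : ∀ i, m i ∈ Ioo (0 : ℝ) 1) (hanti : Antitone m)
    (v : Values n) : ∑ i : Fin n with i.val < cutoff m, v i
      ≤ highest v + (cutoff m - 1) * secondHighest v := by
  obtain ⟨hk1, hk2, -⟩ := cutoff_mem (by omega) hm hanti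
  obtain ⟨i, hi⟩ := exists_eq_highest (by omega) v
  have hle : ∀ j, j ≠ i → v j ≤ secondHighest v := fun j hj => by
    have h := min_le_secondHighest v hj.symm
    rwa [min_eq_right (hi ▸ le_highest v j)] at h
  by_cases hik : i.val < cutoff m
  · have hmem : i ∈ Finset.univ.filter fun i : Fin n => i.val < cutoff m := by simpa using hik
    rw [← Finset.add_sum_erase _ _ hmem, hi]
    have h1 := Finset.sum_le_card_nsmul ((Finset.univ.filter fun i : Fin n =>
      i.val < cutoff m).erase i) v (secondHighest v) fun j hj => hle j (Finset.ne_of_mem_erase hj)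
    rw [Finset.card_erase_of_mem hmem, card_filter_val_lt hk2, nsmul_eq_mul,
      Nat.cast_sub hk1, Nat.cast_one] at h1
    linarith
  · have h1 := Finset.sum_le_card_nsmul (Finset.univ.filter fun i : Fin n =>
      i.val < cutoff m) v (secondHighest v) fun j hj => hle j (by
        rintro rfl; exact hik (by simpa using hj))
    rw [card_filter_val_lt hk2, nsmul_eq_mul] at h1
    linarith [secondHighest_le_highest hn v]

lemma le_winnerPayment (hn : 2 ≤ n) (hm : ∀ i, m i ∈ Ioo (0 : ℝ) 1) (hanti : Antitone m)
    {v : Values n} (hv : v ∈ Icc (0 : Values n) 1) :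
    (∑ i : Fin n with i.val < cutoff m, v i - alpha m)
      / ((cutoff m : ℝ) - 1 - Real.log (alpha m)) ≤ winnerPayment (optimalReserve m) v := by
  have ha := (alpha_spec (by omega) hm hanti).1
  rw [winnerPayment_optimalReserve hn hm hanti hv]
  refine div_le_div_of_nonneg_right ?_ (normalizer_pos (by omega) hm hanti).le
  have hs := secondHighest_mem hn hv
  have hint : ∫ p in Icc (alpha m) 1, (if p < highest v then (1 : ℝ) else 0) ≤
      ∫ p in Icc (alpha m) 1, (if p < highest v then max (secondHighest v) p else 0) / p := by
    refine setIntegral_mono_on ?_ ?_ measurableSet_Icc fun p hp => ?_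
    · exact (integrable_const (1 : ℝ)).mono (Measurable.ite measurableSet_Iio measurable_const
        measurable_const).aestronglyMeasurable (ae_of_all _ fun p => by split_ifs <;> simp)
    · refine Integrable.of_bound (C := 1 / alpha m)
        ((measurable_price v).div measurable_id).aestronglyMeasurable ?_
      filter_upwards [ae_restrict_mem measurableSet_Icc] with p hp
      rw [norm_div]
      have hp0 : 0 < p := ha.1.trans_le hp.1
      have h2 := abs_price_le hn hv ⟨hp0.le, hp.2⟩
      rw [Real.norm_eq_abs p, abs_of_pos hp0]
      exact div_le_div₀ zero_le_one h2 ha.1 hp.1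
    · have hp0 : 0 < p := ha.1.trans_le hp.1
      split_ifs
      · rw [le_div_iff₀ hp0, one_mul]; exact le_max_right _ _
      · simp
  rw [integral_indicator_reserve (highest_mem (by omega) hv).2] at hint
  linarith [sum_active_le hn hm hanti v, le_max_left (highest v - alpha m) 0]

lemma winnerPayment_activeProfile (hn : 2 ≤ n) (hm : ∀ i, m i ∈ Ioo (0 : ℝ) 1)
    (hanti : Antitone m) {i : Fin n} (hi : i.val < cutoff m) {v : Values n}
    (hv : v ∈ Icc (0 : Values n) 1) (hvi : alpha m < v i) (hprof : v = activeProfile m i (v i)) :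
    winnerPayment (optimalReserve m) v = (∑ i : Fin n with i.val < cutoff m, v i - alpha m)
      / ((cutoff m : ℝ) - 1 - Real.log (alpha m)) := by
  have ha := (alpha_spec (by omega) hm hanti).1
  obtain ⟨hk1, hk2, -, hinact⟩ := cutoff_mem (by omega) hm hanti
  have hactive : ∀ j : Fin n, j ≠ i → j.val < cutoff m → v j = alpha m := fun j hj hjk => by
    rw [hprof]; exact activeProfile_of_active hj hjk _
  have hle : ∀ j, j ≠ i → v j ≤ alpha m := by
    intro j hj
    by_cases hjk : j.val < cutoff m
    · exact (hactive j hj hjk).le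
    · rw [hprof, activeProfile_of_inactive hi hjk]
      exact hinact j (not_lt.1 hjk)
  have hhigh : highest v = v i := by
    refine le_antisymm ?_ (le_highest v i)
    obtain ⟨j, hj⟩ := exists_eq_highest (by omega) v
    rw [← hj]
    by_cases hji : j = i
    · rw [hji]
    · exact (hle j hji).trans hvi.le
  have hsec : secondHighest v ≤ alpha m := secondHighest_le hn hle
  have hmem : i ∈ Finset.univ.filter fun i : Fin n => i.val < cutoff m := by simpa using hi
  have hsum : ∑ j : Fin n with j.val < cutoff m, v j = v i + (cutoff m - 1) * alpha m := by
    rw [← Finset.add_sum_erase _ _ hmem, Finset.sum_congr rfl fun j hj =>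
      hactive j (Finset.ne_of_mem_erase hj) (by simpa using Finset.mem_of_mem_erase hj),
      Finset.sum_const, Finset.card_erase_of_mem hmem, card_filter_val_lt hk2, nsmul_eq_mul,
      Nat.cast_sub hk1, Nat.cast_one]
  have hsec2 : ((cutoff m : ℝ) - 1) * secondHighest v = (cutoff m - 1) * alpha m := by
    -- For `k = 1` the coefficient vanishes, and `v⁽²⁾` may lie below `α`; for larger `k` another
    -- active bidder sits at `α`.
    rcases hk1.eq_or_lt with hk | hk
    · rw [← hk]; simp
    · congr 1
      refine le_antisymm hsec ?_
      have : ∃ j : Fin n, j ≠ i ∧ j.val < cutoff m := by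
        by_cases h0 : i.val = 0
        · exact ⟨⟨1, by omega⟩, by simp [Fin.ext_iff, h0], hk⟩
        · exact ⟨⟨0, by omega⟩, by simp only [ne_eq, Fin.ext_iff]; omega, by simp; omega⟩
      obtain ⟨j, hj, hjk⟩ := this
      have h := min_le_secondHighest v hj
      rwa [hactive j hj hjk, min_eq_left hvi.le] at h
  rw [winnerPayment_optimalReserve hn hm hanti hv, hsec2, hsum]
  congr 1
  have : ∫ p in Icc (alpha m) 1, (if p < highest v then max (secondHighest v) p else 0) / p
      = ∫ p in Icc (alpha m) 1, (if p < highest v then (1 : ℝ) else 0) := by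
    refine setIntegral_congr_fun measurableSet_Icc fun p hp => ?_
    have hp0 : 0 < p := ha.1.trans_le hp.1
    split_ifs
    · rw [max_eq_right (hsec.trans hp.1), div_self hp0.ne']
    · simp
  rw [this, integral_indicator_reserve (highest_mem (by omega) hv).2, hhigh,
    max_eq_left (by linarith)]
  ring

lemma integral_sum_active (hn : 1 ≤ n) (hm : ∀ i, m i ∈ Ioo (0 : ℝ) 1) (hanti : Antitone m)
    (F : Feasible m) : Integrable (fun v => (∑ i : Fin n with i.val < cutoff m, v i - alpha m)
      / ((cutoff m : ℝ) - 1 - Real.log (alpha m))) F.1 ∧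
    ∫ v, (∑ i : Fin n with i.val < cutoff m, v i - alpha m)
      / ((cutoff m : ℝ) - 1 - Real.log (alpha m)) ∂F.1 = alpha m := by
  have hint : ∀ i : Fin n, Integrable (fun v : Values n => v i) F.1 := fun i => by
    refine Integrable.of_bound (C := 1) (measurable_pi_apply i).aestronglyMeasurable ?_
    filter_upwards [F.2.ae_mem] with v hv
    rw [Real.norm_eq_abs, abs_of_nonneg (hv.1 i)]
    exact hv.2 i
  have hsum : Integrable (fun v : Values n => ∑ i : Fin n with i.val < cutoff m, v i) F.1 :=
    integrable_finsetSum _ fun i _ => hint i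
  refine ⟨(hsum.sub (integrable_const _)).div_const _, ?_⟩
  rw [integral_div, integral_sub hsum (integrable_const _), integral_finsetSum _ fun i _ => hint i]
  simp only [F.2.mean_eq, integral_const, probReal_univ, one_smul]
  rw [(alpha_spec hn hm hanti).2, div_eq_iff (normalizer_pos hn hm hanti).ne']
  ring

lemma alpha_le_revenue (hn : 2 ≤ n) (hm : ∀ i, m i ∈ Ioo (0 : ℝ) 1) (hanti : Antitone m)
    (F : Feasible m) (I : InfoStructure n) :
    alpha m ≤ Mechanism.revenue F I (secondPrice (optimalReserve m)) := by
  have ha := (alpha_spec (by omega) hm hanti).1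
  have := isProbabilityMeasure_optimalReserve (by omega) hm hanti
  have hG := ae_optimalReserve_mem ha
  rw [revenue_secondPrice hn hG ae_optimalReserve_ne]
  obtain ⟨h1, h2⟩ := integral_sum_active (by omega) hm hanti F
  rw [← h2]
  refine integral_mono_ae h1 ?_ ?_
  · refine Integrable.of_bound (C := 1) measurable_winnerPayment.aestronglyMeasurable ?_
    filter_upwards [F.2.ae_mem] with v hv using abs_winnerPayment_le hn hG hv
  · filter_upwards [F.2.ae_mem] with v hv using le_winnerPayment hn hm hanti hv

lemma revenue_worstCase (hn : 2 ≤ n) (hm : ∀ i, m i ∈ Ioo (0 : ℝ) 1) (hanti : Antitone m)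
    (hF : IsFeasible m (worstCase m)) (I : InfoStructure n) :
    Mechanism.revenue ⟨worstCase m, hF⟩ I (secondPrice (optimalReserve m)) = alpha m := by
  have ha := (alpha_spec (by omega) hm hanti).1
  have := isProbabilityMeasure_optimalReserve (by omega) hm hanti
  rw [revenue_secondPrice hn (ae_optimalReserve_mem ha) ae_optimalReserve_ne]
  refine Eq.trans (integral_congr_ae ?_) (integral_sum_active (by omega) hm hanti ⟨_, hF⟩).2
  filter_upwards [hF.ae_mem, ae_worstCase_eq_activeProfile (by omega) hm hanti]
    with v hv ⟨i, hi, hvi, hprof⟩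
  exact winnerPayment_activeProfile hn hm hanti hi hv hvi.1 hprof

end

section

/-! ## The revenue from a single bidder whose value has law `H` -/

/-- A discrete envelope argument. Formally, utility per unit of value, `V = X - T / x`, satisfies
`V' = T / x²`. Finite differences with step `h` avoid any differentiability: incentive compatibility
of type `x + h` against report `x` bounds `V (x + h) - V x` from below, and the integral of these
differences telescopes to the two ends. -/
lemma integral_payment_div_sq_le_aux {a h : ℝ} (ha : a ∈ Ioo (0 : ℝ) 1) {X T : ℝ → ℝ}
    (hX : IntegrableOn X (Ioo a 1)) (hT : IntegrableOn T (Ioo a 1))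
    (hIC : ∀ᵐ y, y ∈ Ioo a 1 → ∀ x ∈ Ioo a 1, y * X x - T x ≤ y * X y - T y)
    (hIR : ∀ᵐ y, y ∈ Ioo a 1 → 0 ≤ y * X y - T y)
    (hIC1 : ∀ x ∈ Ioo a 1, X x - T x ≤ X 1 - T 1) (hh : 0 < h) (hh1 : h < 1 - a) :
    ∫ x in a..(1 - h), T x / x ^ 2 ≤ X 1 - T 1 + (∫ x in (1 - h)..1, |T x|) / a
      + h * ((∫ x in a..1, |T x|) / a ^ 3) := by
  have ha0 := ha.1
  have hdiv : ∀ j : ℕ, IntegrableOn (fun x => T x / x ^ j) (Ioo a 1) := by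
    intro j
    refine Integrable.mono' (hT.abs.div_const (a ^ j)) ?_ ?_
    · exact (hT.aestronglyMeasurable.aemeasurable.div
        (by fun_prop : Measurable fun x : ℝ => x ^ j).aemeasurable).aestronglyMeasurable
    · filter_upwards [ae_restrict_mem measurableSet_Ioo] with x hx
      have hx0 := ha0.trans hx.1
      rw [norm_div, Real.norm_eq_abs, Real.norm_eq_abs, abs_of_pos (pow_pos hx0 j)]
      exact div_le_div_of_nonneg_left (abs_nonneg _) (by positivity)
        (pow_le_pow_left₀ ha0.le hx.1.le j)
  set V : ℝ → ℝ := fun x => X x - T x / x with hV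
  have hVint : IntegrableOn V (Ioo a 1) := by
    have := hdiv 1
    simp only [pow_one] at this
    exact hX.sub this
  have toII : ∀ {f : ℝ → ℝ}, IntegrableOn f (Ioo a 1) → ∀ b c, a ≤ b → b ≤ c → c ≤ 1 →
      IntervalIntegrable f volume b c := by
    intro f hf b c hb hbc hc
    rw [intervalIntegrable_iff_integrableOn_Ioo_of_le hbc]
    exact hf.mono_set (Ioo_subset_Ioo hb hc)
  have hIoo : ∀ b c : ℝ, ∀ᵐ x ∂(volume.restrict (Icc b c)), x ∈ Ioo b c := by
    intro b c
    rw [← restrict_Ioo_eq_restrict_Icc]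
    exact ae_restrict_mem measurableSet_Ioo
  -- Incentive compatibility holds only for almost every type; translation preserves null sets, so
  -- it holds at `x + h` for almost every `x`.
  have hshift : ∀ᵐ x, x + h ∈ Ioo a 1 →
      ∀ z ∈ Ioo a 1, (x + h) * X z - T z ≤ (x + h) * X (x + h) - T (x + h) :=
    (measurePreserving_add_right volume h).quasiMeasurePreserving.ae hIC
  have hstep : ∫ x in a..(1 - h), (h * (T x / x ^ 2) - h ^ 2 / a ^ 3 * |T x|)
      ≤ ∫ x in a..(1 - h), (V (x + h) - V x) := by
    refine intervalIntegral.integral_mono_ae_restrict (by linarith) ?_ ?_ ?_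
    · exact ((toII (hdiv 2) _ _ le_rfl (by linarith) (by linarith)).const_mul h).sub
        ((toII hT.abs _ _ le_rfl (by linarith) (by linarith)).const_mul _)
    · refine IntervalIntegrable.sub ?_ (toII hVint _ _ le_rfl (by linarith) (by linarith))
      have := (toII hVint (a + h) 1 (by linarith) (by linarith) le_rfl).comp_add_right h
      simpa using this
    · filter_upwards [hIoo a (1 - h), ae_restrict_of_ae hshift] with x hx hgood
      have hx0 := ha0.trans hx.1
      have hxh : x + h ∈ Ioo a 1 := ⟨by linarith [hx.1], by linarith [hx.2]⟩
      have h1 := hgood hxh x ⟨hx.1, by linarith [hx.2]⟩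
      have hxh0 : 0 < x + h := by linarith
      have h2 : X x - T x / (x + h) ≤ V (x + h) := by
        have := div_le_div_of_nonneg_right h1 hxh0.le
        simp only [hV]
        rwa [sub_div, sub_div, mul_div_cancel_left₀ _ hxh0.ne',
          mul_div_cancel_left₀ _ hxh0.ne'] at this
      -- Expands `1 / x - 1 / (x + h) = h / x² - h² / (x² (x + h))`; the last term is the
      -- second-order error.
      have h3 : X x - T x / (x + h) = V x + (h * (T x / x ^ 2)
          - h ^ 2 / (x ^ 2 * (x + h)) * T x) := by
        simp only [hV]; field_simp; ring
      have h4 : h ^ 2 / (x ^ 2 * (x + h)) * T x ≤ h ^ 2 / a ^ 3 * |T x| := by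
        refine (mul_le_mul_of_nonneg_left (le_abs_self _) (by positivity)).trans ?_
        refine mul_le_mul_of_nonneg_right ?_ (abs_nonneg _)
        refine div_le_div_of_nonneg_left (by positivity) (by positivity) ?_
        calc a ^ 3 = a ^ 2 * a := by ring
          _ ≤ x ^ 2 * (x + h) := by
            have := hx.1
            gcongr
            linarith
      linarith
  have htel : ∫ x in a..(1 - h), (V (x + h) - V x)
      = (∫ x in (1 - h)..1, V x) - ∫ x in a..(a + h), V x := by
    have e1 : IntervalIntegrable (fun x => V (x + h)) volume a (1 - h) := by
      have := (toII hVint (a + h) 1 (by linarith) (by linarith) le_rfl).comp_add_right h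
      simpa using this
    rw [intervalIntegral.integral_sub e1 (toII hVint _ _ le_rfl (by linarith) (by linarith)),
      intervalIntegral.integral_comp_add_right, sub_add_cancel]
    have e2 := intervalIntegral.integral_add_adjacent_intervals
      (toII hVint a (a + h) le_rfl (by linarith) (by linarith))
      (toII hVint (a + h) 1 (by linarith) (by linarith) le_rfl)
    have e3 := intervalIntegral.integral_add_adjacent_intervals
      (toII hVint a (1 - h) le_rfl (by linarith) (by linarith))
      (toII hVint (1 - h) 1 (by linarith) (by linarith) le_rfl)
    linarith
  have hVnn : 0 ≤ ∫ x in a..(a + h), V x := by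
    refine intervalIntegral.integral_nonneg_of_ae_restrict (by linarith) ?_
    filter_upwards [hIoo a (a + h), ae_restrict_of_ae hIR] with x hx hgood
    have hx0 := ha0.trans hx.1
    have := div_nonneg (hgood ⟨hx.1, by linarith [hx.2]⟩) hx0.le
    rwa [sub_div, mul_div_cancel_left₀ _ hx0.ne'] at this
  -- Near the top, `V` differs from `X - T` by `T (1 - x) / x`, which is small, and type `1` does
  -- not envy `x`.
  have hVtop : ∫ x in (1 - h)..1, V x
      ≤ ∫ x in (1 - h)..1, ((X 1 - T 1) + h / a * |T x|) := by
    refine intervalIntegral.integral_mono_ae_restrict (by linarith)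
      (toII hVint _ _ (by linarith) (by linarith) le_rfl)
      (intervalIntegrable_const.add
        ((toII hT.abs _ _ (by linarith) (by linarith) le_rfl).const_mul _)) ?_
    filter_upwards [hIoo (1 - h) 1] with x hx
    have hxa : a < x := by linarith [hx.1]
    have hx0 := ha0.trans hxa
    have h1 := hIC1 x ⟨hxa, hx.2⟩
    have h2 : V x = X x - T x - T x * ((1 - x) / x) := by simp only [hV]; field_simp; ring
    have h3 : -(T x * ((1 - x) / x)) ≤ h / a * |T x| := by
      rw [← neg_mul, mul_comm]
      have h5 : 0 ≤ (1 - x) / x := div_nonneg (by linarith [hx.2]) hx0.le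
      refine (mul_le_mul_of_nonneg_left (neg_le_abs _) h5).trans ?_
      refine mul_le_mul_of_nonneg_right ?_ (abs_nonneg _)
      exact div_le_div₀ hh.le (by linarith [hx.1]) ha0 hxa.le
    linarith
  rw [intervalIntegral.integral_add intervalIntegrable_const
      ((toII hT.abs _ _ (by linarith) (by linarith) le_rfl).const_mul _),
    intervalIntegral.integral_const, intervalIntegral.integral_const_mul, smul_eq_mul] at hVtop
  rw [intervalIntegral.integral_sub
      ((toII (hdiv 2) _ _ le_rfl (by linarith) (by linarith)).const_mul h)
      ((toII hT.abs _ _ le_rfl (by linarith) (by linarith)).const_mul _),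
    intervalIntegral.integral_const_mul, intervalIntegral.integral_const_mul] at hstep
  have hmono : ∫ x in a..(1 - h), |T x| ≤ ∫ x in a..1, |T x| := by
    refine intervalIntegral.integral_mono_interval le_rfl (by linarith) (by linarith)
      (ae_of_all _ fun x => abs_nonneg _) (toII hT.abs _ _ le_rfl ha.2.le le_rfl)
  have hmono2 : h ^ 2 / a ^ 3 * ∫ x in a..(1 - h), |T x|
      ≤ h ^ 2 / a ^ 3 * ∫ x in a..1, |T x| := mul_le_mul_of_nonneg_left hmono (by positivity)
  refine le_of_mul_le_mul_left ?_ hh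
  have : h * (X 1 - T 1 + (∫ x in (1 - h)..1, |T x|) / a + h * ((∫ x in a..1, |T x|) / a ^ 3))
      = (1 - (1 - h)) * (X 1 - T 1) + h / a * (∫ x in (1 - h)..1, |T x|)
        + h ^ 2 / a ^ 3 * ∫ x in a..1, |T x| := by ring
  rw [this]
  linarith

/-- The limit `h → 0⁺` of the discrete bound; the error terms vanish because `T` is integrable. -/
lemma integral_payment_div_sq_le {a : ℝ} (ha : a ∈ Ioo (0 : ℝ) 1) {X T : ℝ → ℝ}
    (hX : IntegrableOn X (Ioo a 1)) (hT : IntegrableOn T (Ioo a 1))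
    (hIC : ∀ᵐ y, y ∈ Ioo a 1 → ∀ x ∈ Ioo a 1, y * X x - T x ≤ y * X y - T y)
    (hIR : ∀ᵐ y, y ∈ Ioo a 1 → 0 ≤ y * X y - T y)
    (hIC1 : ∀ x ∈ Ioo a 1, X x - T x ≤ X 1 - T 1)
    (hT2 : IntegrableOn (fun x => T x / x ^ 2) (Ioo a 1)) :
    ∫ x in a..1, T x / x ^ 2 ≤ X 1 - T 1 := by
  have hcont : ∀ {f : ℝ → ℝ}, IntegrableOn f (Ioo a 1) →
      Filter.Tendsto (fun h => ∫ x in a..(1 - h), f x) (nhdsWithin 0 (Ioi 0))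
        (nhds (∫ x in a..1, f x)) := by
    intro f hf
    have hII : IntervalIntegrable f volume a 1 :=
      (intervalIntegrable_iff_integrableOn_Ioo_of_le ha.2.le).2 hf
    have hc := intervalIntegral.continuousOn_primitive_interval' hII left_mem_uIcc
    have h1 := hc 1 right_mem_uIcc
    refine Filter.Tendsto.comp h1 ?_
    refine tendsto_nhdsWithin_iff.2 ⟨?_, ?_⟩
    · refine Filter.Tendsto.mono_left ?_ nhdsWithin_le_nhds
      have : Continuous fun h : ℝ => 1 - h := by fun_prop
      simpa using this.tendsto 0
    · have : Ioo (0 : ℝ) (1 - a) ∈ nhdsWithin (0 : ℝ) (Ioi 0) :=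
        Ioo_mem_nhdsGT (by linarith [ha.2])
      filter_upwards [this] with h hh
      rw [uIcc_of_le ha.2.le]
      exact ⟨by linarith [hh.2], by linarith [hh.1]⟩
  have hT' : Integrable (fun x => |T x|) (volume.restrict (Ioo a 1)) := hT.abs
  have hrest : Filter.Tendsto (fun h => ∫ x in (1 - h)..1, |T x|) (nhdsWithin 0 (Ioi 0))
      (nhds 0) := by
    have h1 := (hcont hT').const_sub (∫ x in a..1, |T x|)
    rw [sub_self] at h1
    refine h1.congr' ?_
    have : Ioo (0 : ℝ) (1 - a) ∈ nhdsWithin (0 : ℝ) (Ioi 0) :=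
      Ioo_mem_nhdsGT (by linarith [ha.2])
    filter_upwards [this] with h hh
    have hII : ∀ b c, a ≤ b → b ≤ c → c ≤ 1 →
        IntervalIntegrable (fun x => |T x|) volume b c := by
      intro b c hb hbc hc
      rw [intervalIntegrable_iff_integrableOn_Ioo_of_le hbc]
      exact IntegrableOn.mono_set hT' (Ioo_subset_Ioo hb hc)
    have := intervalIntegral.integral_add_adjacent_intervals
      (hII a (1 - h) le_rfl (by linarith [hh.2]) (by linarith [hh.1]))
      (hII (1 - h) 1 (by linarith [hh.2]) (by linarith [hh.1]) le_rfl)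
    linarith
  have hid : Filter.Tendsto (fun h : ℝ => h) (nhdsWithin 0 (Ioi 0)) (nhds 0) :=
    Filter.Tendsto.mono_left Filter.tendsto_id nhdsWithin_le_nhds
  have hright := ((hrest.div_const a).const_add (X 1 - T 1)).add
    (hid.mul_const ((∫ x in a..1, |T x|) / a ^ 3))
  simp only [zero_div, zero_mul, add_zero] at hright
  refine le_of_tendsto_of_tendsto (hcont hT2) hright ?_
  have : Ioo (0 : ℝ) (1 - a) ∈ nhdsWithin (0 : ℝ) (Ioi 0) :=
    Ioo_mem_nhdsGT (by linarith [ha.2])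
  filter_upwards [this] with h hh
  exact integral_payment_div_sq_le_aux ha hX hT hIC hIR hIC1 hh.1 hh.2

/-- A bidder whose value has law `H` pays at most `α` in expectation. -/
lemma integral_payment_highLaw_le {a : ℝ} (ha : a ∈ Ioo (0 : ℝ) 1) {X T : ℝ → ℝ}
    (hXm : Measurable X) (hX : ∀ x ∈ Icc (0 : ℝ) 1, X x ∈ Icc (0 : ℝ) 1) (hTm : Measurable T)
    (hT : Integrable T (highLaw a))
    (hIC : ∀ᵐ y ∂(highLaw a), ∀ x ∈ Icc (0 : ℝ) 1, y * X x - T x ≤ y * X y - T y)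
    (hIR : ∀ᵐ y ∂(highLaw a), 0 ≤ y * X y - T y) :
    ∫ x, T x ∂(highLaw a) ≤ a := by
  have ha0 := ha.1
  have hsub : ∀ x ∈ Ioo a 1, x ∈ Icc (0 : ℝ) 1 := fun x hx => ⟨(ha0.trans hx.1).le, hx.2.le⟩
  rw [ae_highLaw_iff ha] at hIC hIR
  have hT2 : IntegrableOn (fun x => T x / x ^ 2) (Ioo a 1) := by
    have := ((integrable_highLaw_iff ha).1 hT).const_mul (1 / a)
    refine this.congr (ae_of_all _ fun x => ?_)
    simp only; field_simp
  have hTi : IntegrableOn T (Ioo a 1) := by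
    refine Integrable.mono hT2 hTm.aestronglyMeasurable ?_
    filter_upwards [ae_restrict_mem measurableSet_Ioo] with x hx
    have hx0 := ha0.trans hx.1
    rw [norm_div, Real.norm_eq_abs (x ^ 2), abs_of_pos (by positivity)]
    exact le_div_self (norm_nonneg _) (by positivity) (pow_le_one₀ hx0.le hx.2.le)
  have hXi : IntegrableOn X (Ioo a 1) := by
    refine Integrable.of_bound (C := 1) hXm.aestronglyMeasurable ?_
    filter_upwards [ae_restrict_mem measurableSet_Ioo] with x hx
    have := hX x (hsub x hx)
    rw [Real.norm_eq_abs, abs_of_nonneg this.1]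
    exact this.2
  have key := integral_payment_div_sq_le ha hXi hTi
    (by
      filter_upwards [(ae_restrict_iff' measurableSet_Ioo).1 hIC.1] with y hy hmem x hx
      exact hy hmem x (hsub x hx))
    ((ae_restrict_iff' measurableSet_Ioo).1 hIR.1)
    (fun x hx => by simpa using hIC.2 x (hsub x hx)) hT2
  rw [intervalIntegral.integral_of_le ha.2.le, integral_Ioc_eq_integral_Ioo] at key
  rw [integral_highLaw ha hT]
  have : ∫ x in Ioo a 1, a / x ^ 2 * T x = a * ∫ x in Ioo a 1, T x / x ^ 2 := by
    rw [← integral_const_mul]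
    congr 1 with x
    ring
  rw [this]
  -- The atom contributes `a * T 1`, which cancels the `-T 1` of the envelope bound and leaves `a *
  -- X 1 ≤ a`.
  have h1 := mul_le_mul_of_nonneg_left key ha0.le
  have h2 := mul_le_mul_of_nonneg_left (hX 1 ⟨zero_le_one, le_rfl⟩).2 ha0.le
  linarith

end

section

/-! ## The revenue bound at the worst-case distribution -/

variable {n : ℕ} {m : Fin n → ℝ}

/-- The profile of values `v` with trivial signals. -/
def nullProfile (v : Values n) : (InfoStructure.null n).Profile := (v, fun _ => ())

lemma measurable_nullProfile : Measurable (nullProfile (n := n)) :=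
  measurable_id.prodMk measurable_const

lemma law_null (F : Measure (Values n)) [IsProbabilityMeasure F] :
    law F (InfoStructure.null n) = F.map nullProfile := by
  change F ⊗ₘ (Kernel.const _ (Measure.dirac fun _ => ())) = _
  rw [Measure.compProd_const, Measure.prod_dirac]
  rfl

/-- Positive mass puts `b` into the support and makes conditioning on `v i = b` meaningful. -/
lemma nonCompetitive_of_ae {F : Measure (Values n)} [IsProbabilityMeasure F] {i : Fin n} {b : ℝ}
    (hle : ∀ᵐ v ∂F, b ≤ v i) (hrival : ∀ᵐ v ∂F, ∃ j, b < v j) (hpos : F {v | v i = b} ≠ 0) :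
    NonCompetitive F i b := by
  have hmi : Measurable fun v : Values n => v i := measurable_pi_apply i
  refine ⟨⟨?_, fun y hy => ?_⟩, ?_⟩
  · rw [Measure.mem_support_iff_forall]
    intro U hU
    refine lt_of_lt_of_le (pos_iff_ne_zero.2 hpos) ?_
    have : F {v | v i = b} = (F.map fun v => v i) {b} := by
      rw [Measure.map_apply hmi (measurableSet_singleton b)]; rfl
    rw [this]
    exact measure_mono (singleton_subset_iff.2 (mem_of_mem_nhds hU))
  · by_contra! hlt
    have h1 := (Measure.mem_support_iff_forall y).1 hy (Iio b) (Iio_mem_nhds hlt)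
    rw [Measure.map_apply hmi measurableSet_Iio] at h1
    refine h1.ne' ?_
    rw [ae_iff] at hle
    refine measure_mono_null (fun v hv => ?_) hle
    simpa using hv
  · have hprob := cond_isProbabilityMeasure hpos
    have hac : F[|{v | v i = b}] ≪ F := cond_absolutelyContinuous
    have hrival' : ∀ᵐ v ∂(F[|{v | v i = b}]), ∃ j, b < v j := hac.ae_le hrival
    rw [← mem_ae_iff_prob_eq_one]
    · exact hrival'
    · rw [ofPred_exists]
      exact MeasurableSet.iUnion fun j => measurableSet_Ioi.preimage (measurable_pi_apply j)

lemma ae_worstCase_nonCompetitive (hn : 1 ≤ n) (hm : ∀ i, m i ∈ Ioo (0 : ℝ) 1)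
    (hanti : Antitone m) (i : Fin n) :
    ∀ᵐ v ∂(worstCase m), v i ≤ alpha m → NonCompetitive (worstCase m) i (v i) := by
  have hF := isProbabilityMeasure_worstCase hn hm hanti
  obtain ⟨-, -, -, hinact⟩ := cutoff_mem hn hm hanti
  have hae := ae_worstCase_eq_activeProfile hn hm hanti
  set b := if i.val < cutoff m then alpha m else m i with hb
  have hbα : b ≤ alpha m := by
    rw [hb]; split_ifs with h
    · exact le_rfl
    · exact hinact i (not_lt.1 h)
  have hval : ∀ᵐ v ∂(worstCase m), b ≤ v i ∧ (v i ≤ alpha m → v i = b) := by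
    filter_upwards [hae] with v ⟨j, hj, hvj, hprof⟩
    by_cases hij : i = j
    · subst hij
      exact ⟨hbα.trans hvj.1.le, fun h => absurd h (not_le.2 hvj.1)⟩
    · have : v i = b := by
        rw [hprof, hb]
        by_cases h : i.val < cutoff m
        · rw [activeProfile_of_active hij h, if_pos h]
        · rw [activeProfile_of_inactive hj h, if_neg h]
      exact ⟨this.ge, fun _ => this⟩
  -- The null case occurs for a sole active bidder, who is always above `α`; the claim is then
  -- vacuous.
  by_cases hpos : worstCase m {v | v i = b} = 0
  · have : ∀ᵐ v ∂(worstCase m), v i ≠ b := by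
      rw [ae_iff]; simpa using hpos
    filter_upwards [this, hval] with v h1 h2 h3 using absurd (h2.2 h3) h1
  · have hnc : NonCompetitive (worstCase m) i b := by
      refine nonCompetitive_of_ae ?_ ?_ hpos
      · filter_upwards [hval] with v hv using hv.1
      · filter_upwards [hae] with v ⟨j, hj, hvj, _⟩ using ⟨j, hbα.trans_lt hvj.1⟩
    filter_upwards [hval] with v hv hle
    rwa [hv.2 hle]

/-! ### Payments of low and high types in a competitive direct mechanism -/

variable {D : DirectMechanism (InfoStructure.null n)}

lemma report_self {i : Fin n} {τ : (InfoStructure.null n).OwnType i}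
    {ω : (InfoStructure.null n).Profile} (h : ω.1 i = τ.1) :
    (InfoStructure.null n).report i τ ω = ω := by
  refine Prod.ext ?_ (funext fun _ => rfl)
  change Function.update ω.1 i τ.1 = ω.1
  rw [← h, Function.update_eq_self]

/-- Low types get no good, so their utility is minus the payment; averaging individual rationality
over them gives the sign. -/
lemma integral_payment_lowTypes_nonpos (F : Feasible m) (hD : D.IsCompetitive F) (i : Fin n)
    {a : ℝ} (hnc : ∀ᵐ v ∂F.1, v i ≤ a → NonCompetitive F.1 i (v i)) :
    ∫ ω in {ω | ω.1 i ≤ a}, D.t i ω ∂(law F.1 (InfoStructure.null n)) ≤ 0 := by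
  set μ := law F.1 (InfoStructure.null n)
  have hmX := measurable_ownType (InfoStructure.null n) i
  have hmi : Measurable fun ω : (InfoStructure.null n).Profile => ω.1 i := (measurable_pi_apply i).comp measurable_fst
  set g : (InfoStructure.null n).Profile → ℝ := fun ω => ω.1 i * D.x i ω - D.t i ω with hg
  have hgm : Measurable g :=
    (hmi.mul (hD.regular.measurable_x i)).sub (hD.regular.measurable_t i)
  have hgi : Integrable g μ := by
    refine Integrable.sub ?_ (hD.regular.integrable_t i)
    refine Integrable.of_bound (C := 1)
      (hmi.mul (hD.regular.measurable_x i)).aestronglyMeasurable ?_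
    filter_upwards [ae_law_of_ae (InfoStructure.null n) F.2.ae_mem] with ω hω
    have hx := hD.regular.x_mem i ω hω
    rw [Real.norm_eq_abs, abs_of_nonneg (mul_nonneg (hω.1 i) hx.1)]
    exact mul_le_one₀ (hω.2 i) hx.1 hx.2
  have hS : MeasurableSet {ω : (InfoStructure.null n).Profile | ω.1 i ≤ a} := hmi measurableSet_Iic
  have htruth : ∀ᵐ τ ∂(μ.map ((InfoStructure.null n).ownType i)), 0 ≤ ∫ ω, g ω ∂(condDistrib id ((InfoStructure.null n).ownType i) μ τ) := by
    have hQ := ae_ae_condDistrib (μ := μ) (P := fun τ ω => ω.1 i = τ.1) hmX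
      (measurableSet_eq_fun (hmi.comp measurable_snd) (measurable_fst.comp measurable_fst))
      (ae_of_all _ fun ω => rfl)
    filter_upwards [hQ, hD.ir i] with τ h1 h2
    refine h2.trans_eq (integral_congr_ae ?_)
    filter_upwards [h1] with ω hω
    rw [report_self hω, ← hω]
  have hnn : 0 ≤ ∫ ω in {ω | ω.1 i ≤ a}, g ω ∂μ := by
    -- Being low is read off the type coordinate, so integrating out the conditional law leaves the
    -- truthful interim utility of low types and zero for the others.
    let f : (InfoStructure.null n).OwnType i × (InfoStructure.null n).Profile → ℝ := fun p => if p.1.1 ≤ a then g p.2 else 0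
    have hfm : Measurable f := Measurable.ite
      (measurableSet_Iic.preimage (measurable_fst.comp measurable_fst))
      (hgm.comp measurable_snd) measurable_const
    have hmap : μ.map ((InfoStructure.null n).ownType i) ⊗ₘ
        condDistrib id ((InfoStructure.null n).ownType i) μ
        = μ.map fun ω => ((InfoStructure.null n).ownType i ω, id ω) :=
      compProd_map_condDistrib aemeasurable_id
    have hpair : Measurable fun ω => ((InfoStructure.null n).ownType i ω, id ω) := hmX.prodMk measurable_id
    have hcomp : (fun ω => f ((InfoStructure.null n).ownType i ω, id ω)) = {ω | ω.1 i ≤ a}.indicator g := by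
      ext ω; simp only [f, indicator, mem_ofPred_eq, id]; rfl
    have hfi : Integrable f (μ.map ((InfoStructure.null n).ownType i) ⊗ₘ condDistrib id ((InfoStructure.null n).ownType i) μ) := by
      rw [hmap, integrable_map_measure hfm.aestronglyMeasurable hpair.aemeasurable]
      change Integrable (fun ω => f ((InfoStructure.null n).ownType i ω, id ω)) μ
      rw [hcomp]
      exact hgi.indicator hS
    rw [← integral_indicator hS, ← hcomp,
      ← integral_map hpair.aemeasurable hfm.aestronglyMeasurable, ← hmap,
      Measure.integral_compProd hfi]
    refine integral_nonneg_of_ae ?_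
    filter_upwards [htruth] with τ hτ
    by_cases h : τ.1 ≤ a
    · simpa [f, h] using hτ
    · simp [f, h]
  have hneg : ∫ ω in {ω | ω.1 i ≤ a}, g ω ∂μ = ∫ ω in {ω | ω.1 i ≤ a}, -D.t i ω ∂μ := by
    refine setIntegral_congr_ae hS ?_
    filter_upwards [hD.noncompetitive i, ae_law_of_ae (InfoStructure.null n) hnc] with ω h1 h2 h3
    rw [hg]
    simp only [h1 (h2 h3), mul_zero, zero_sub]
  rw [hneg, integral_neg] at hnn
  linarith

/-- Bidder `i` exceeds `α` only in the mixture component where he is the chosen one. -/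
lemma integral_payment_highTypes (hn : 1 ≤ n) (hm : ∀ i, m i ∈ Ioo (0 : ℝ) 1) (hanti : Antitone m)
    (hF : IsFeasible m (worstCase m)) (hD : D.IsCompetitive (⟨worstCase m, hF⟩ : Feasible m))
    (i : Fin n) :
    ∫ ω in {ω | ω.1 i ≤ alpha m}ᶜ, D.t i ω ∂(law (worstCase m) (InfoStructure.null n))
      = if i.val < cutoff m then theta m i *
        ∫ x, D.t i (nullProfile (activeProfile m i x)) ∂(highLaw (alpha m)) else 0 := by
  have hprob := hF.isProb
  have ha := (alpha_spec hn hm hanti).1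
  obtain ⟨-, -, -, hinact⟩ := cutoff_mem hn hm hanti
  have hmt := (hD.regular.measurable_t i)
  have hti : Integrable (D.t i) (law (worstCase m) (InfoStructure.null n)) :=
    hD.regular.integrable_t i
  have hS : MeasurableSet {ω : (InfoStructure.null n).Profile | ω.1 i ≤ alpha m} :=
    ((measurable_pi_apply i).comp measurable_fst) measurableSet_Iic
  have hind : Integrable ({ω | ω.1 i ≤ alpha m}ᶜ.indicator (D.t i))
      ((worstCase m).map nullProfile) := by
    rw [← law_null]; exact hti.indicator hS.compl
  have hindm := hmt.indicator hS.compl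
  rw [← integral_indicator hS.compl, law_null,
    integral_map measurable_nullProfile.aemeasurable hindm.aestronglyMeasurable,
    integral_worstCase hn hm hanti (f := fun v => {ω : (InfoStructure.null n).Profile | ω.1 i ≤ alpha m}ᶜ.indicator (D.t i)
      (nullProfile v)) (hindm.comp measurable_nullProfile)
      (hind.comp_measurable measurable_nullProfile)]
  have key : ∀ j : Fin n, j.val < cutoff m → theta m j * ∫ x,
      {ω : (InfoStructure.null n).Profile | ω.1 i ≤ alpha m}ᶜ.indicator (D.t i)
        (nullProfile (activeProfile m j x))
        ∂(highLaw (alpha m)) = if j = i then theta m i *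
        ∫ x, D.t i (nullProfile (activeProfile m i x)) ∂(highLaw (alpha m)) else 0 := by
    intro j hj
    split_ifs with hji
    · subst hji
      congr 1
      refine integral_congr_ae ?_
      filter_upwards [ae_highLaw_mem ha] with x hx
      refine indicator_of_mem ?_ _
      change ¬ (activeProfile m j x j ≤ alpha m)
      rw [activeProfile_self, not_le]
      exact hx.1
    · rw [integral_eq_zero_of_ae, mul_zero]
      refine ae_of_all _ fun x => indicator_of_notMem ?_ _
      rw [notMem_compl_iff]
      change activeProfile m j x i ≤ alpha m
      by_cases h : i.val < cutoff m
      · rw [activeProfile_of_active (Ne.symm hji) h]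
      · rw [activeProfile_of_inactive hj h]; exact hinact i (not_lt.1 h)
  refine (Finset.sum_congr rfl fun j hj => key j (by simpa using hj)).trans ?_
  rw [Finset.sum_ite_eq']
  simp

lemma integral_payment_active_le (hn : 1 ≤ n) (hm : ∀ i, m i ∈ Ioo (0 : ℝ) 1) (hanti : Antitone m)
    (hF : IsFeasible m (worstCase m)) (hD : D.IsCompetitive (⟨worstCase m, hF⟩ : Feasible m))
    {i : Fin n} (hi : i.val < cutoff m) :
    ∫ x, D.t i (nullProfile (activeProfile m i x)) ∂(highLaw (alpha m)) ≤ alpha m := by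
  have hprob := hF.isProb
  have ha := (alpha_spec hn hm hanti).1
  have hmX := measurable_ownType (InfoStructure.null n) i
  have hmi : Measurable fun ω : (InfoStructure.null n).Profile => ω.1 i := (measurable_pi_apply i).comp measurable_fst
  have hme : Measurable fun x => nullProfile (activeProfile m i x) :=
    measurable_nullProfile.comp (measurable_activeProfile i)
  have hti : Integrable (fun v => D.t i (nullProfile v)) (worstCase m) := by
    have h := hD.regular.integrable_t i
    rw [law_null] at h
    exact h.comp_measurable measurable_nullProfile
  have htransfer : ∀ {P : (InfoStructure.null n).OwnType i → Prop},
      (∀ᵐ τ ∂((law (worstCase m) (InfoStructure.null n)).map ((InfoStructure.null n).ownType i)), P τ) →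
      ∀ᵐ x ∂(highLaw (alpha m)), P (x, ()) := by
    intro P h
    have h1 := ae_of_ae_map hmX.aemeasurable h
    rw [law_null] at h1
    have h2 := ae_of_ae_map measurable_nullProfile.aemeasurable h1
    have h3 := ae_of_ae_worstCase hn hm hanti h2 hi
    filter_upwards [h3] with x hx
    have : (InfoStructure.null n).ownType i (nullProfile (activeProfile m i x)) = (x, ()) := by
      change (activeProfile m i x i, ()) = (x, ())
      rw [activeProfile_self]
    rwa [this] at hx
  -- A value above `α` reveals the rivals' values, so interim utilities are ex-post payoffs along
  -- `activeProfile m i`. The null set does not depend on the report `r`.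
  have hcond : ∀ᵐ x ∂(highLaw (alpha m)), ∀ r : (InfoStructure.null n).OwnType i,
      D.interimUtility (worstCase m) i r (x, ())
        = x * D.x i (nullProfile (activeProfile m i r.1))
          - D.t i (nullProfile (activeProfile m i r.1)) := by
    have hQ := ae_ae_condDistrib (μ := law (worstCase m) (InfoStructure.null n))
      (P := fun τ ω => alpha m < τ.1 → ω.1 = activeProfile m i τ.1) hmX (by
        have h1 : MeasurableSet {p : (InfoStructure.null n).OwnType i × (InfoStructure.null n).Profile | alpha m < p.1.1} :=
          measurableSet_Ioi.preimage (measurable_fst.comp measurable_fst)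
        have h2 : MeasurableSet {p : (InfoStructure.null n).OwnType i × (InfoStructure.null n).Profile | p.2.1 = activeProfile m i p.1.1} :=
          measurableSet_eq_fun (measurable_fst.comp measurable_snd)
            ((measurable_activeProfile i).comp (measurable_fst.comp measurable_fst))
        exact h1.imp h2)
      (by
        filter_upwards [ae_law_of_ae (InfoStructure.null n) (ae_worstCase_eq_activeProfile hn hm hanti)]
          with ω ⟨j, hj, hvj, hprof⟩ hα
        have hα : alpha m < ω.1 i := hα
        have hji : j = i := by
          by_contra hne
          rw [hprof, activeProfile_of_active (Ne.symm hne) hi] at hα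
          exact lt_irrefl _ hα
        subst hji
        exact hprof)
    filter_upwards [htransfer hQ, ae_highLaw_mem ha] with x hx hxa r
    have hx := hx
    rw [DirectMechanism.interimUtility]
    have : ∀ᵐ ω ∂(condDistrib id ((InfoStructure.null n).ownType i) (law (worstCase m) (InfoStructure.null n)) (x, ())),
        x * D.x i ((InfoStructure.null n).report i r ω) - D.t i ((InfoStructure.null n).report i r ω)
          = x * D.x i (nullProfile (activeProfile m i r.1))
          - D.t i (nullProfile (activeProfile m i r.1)) := by
      filter_upwards [hx] with ω hω
      have h1 : (InfoStructure.null n).report i r ω = nullProfile (activeProfile m i r.1) := by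
        refine Prod.ext ?_ (funext fun _ => rfl)
        change Function.update ω.1 i r.1 = activeProfile m i r.1
        rw [hω hxa.1, activeProfile, Function.update_idem, activeProfile]
      rw [h1]
    rw [integral_congr_ae this, integral_const, probReal_univ, one_smul]
  refine integral_payment_highLaw_le ha (X := fun x => D.x i (nullProfile (activeProfile m i x)))
    ((hD.regular.measurable_x i).comp hme) (fun x hx => ?_) ((hD.regular.measurable_t i).comp hme)
    ?_ ?_ ?_
  · refine hD.regular.x_mem i _ ?_
    refine update_mem ?_ i hx
    rw [← pi_univ_Icc, mem_univ_pi]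
    intro j
    split_ifs
    · exact Ioo_subset_Icc_self ha
    · exact Ioo_subset_Icc_self (hm j)
  · exact (integrable_worstCase_iff hn hm hanti
      ((hD.regular.measurable_t i).comp measurable_nullProfile)).1 hti i hi
  · filter_upwards [htransfer (hD.ic i), hcond] with x h1 h2 r hr
    have h3 := h1 (r, ()) hr
    rwa [h2, h2] at h3
  · filter_upwards [htransfer (hD.ir i), hcond] with x h1 h2
    rwa [h2] at h1

lemma revenue_le_alpha (hn : 1 ≤ n) (hm : ∀ i, m i ∈ Ioo (0 : ℝ) 1) (hanti : Antitone m)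
    (hF : IsFeasible m (worstCase m)) (hD : D.IsCompetitive (⟨worstCase m, hF⟩ : Feasible m)) :
    D.revenue (worstCase m) ≤ alpha m := by
  have hprob := hF.isProb
  have hS : ∀ i, MeasurableSet {ω : (InfoStructure.null n).Profile | ω.1 i ≤ alpha m} := fun i =>
    ((measurable_pi_apply i).comp measurable_fst) measurableSet_Iic
  have hle : ∀ i : Fin n, ∫ ω, D.t i ω ∂(law (worstCase m) (InfoStructure.null n))
      ≤ if i.val < cutoff m then theta m i * alpha m else 0 := by
    intro i
    rw [← integral_add_compl (hS i) (hD.regular.integrable_t i),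
      integral_payment_highTypes hn hm hanti hF hD i]
    have h1 := integral_payment_lowTypes_nonpos _ hD i (ae_worstCase_nonCompetitive hn hm hanti i)
    split_ifs with hi
    · have h2 := mul_le_mul_of_nonneg_left (integral_payment_active_le hn hm hanti hF hD hi)
        (theta_pos hn hm hanti hi).le
      linarith
    · linarith
  calc D.revenue (worstCase m)
      ≤ ∑ i : Fin n, if i.val < cutoff m then theta m i * alpha m else 0 :=
        Finset.sum_le_sum fun i _ => hle i
    _ = alpha m := by
        rw [← Finset.sum_filter, ← Finset.sum_mul, sum_theta hn hm hanti, one_mul]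

end

end RobustAuction

/-- The second-price auction with the random reserve price `G*` attains the optimal revenue
guarantee among all competitive mechanisms. -/
theorem theorem2 (n : ℕ) (hn : 2 ≤ n) (m : Fin n → ℝ) (hm : ∀ i, m i ∈ Ioo (0 : ℝ) 1)
    (hanti : Antitone m) :
    -- `G*` is a probability distribution on `[0,1]`
    (IsProbabilityMeasure (optimalReserve m) ∧ ∀ᵐ r ∂(optimalReserve m), r ∈ Icc (0 : ℝ) 1) ∧
    -- `S_{G*}` is a competitive mechanism and never sells more than one unit
    (secondPrice (optimalReserve m) : Mechanism m) ∈ Mechanism.competitive m ∧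
    (∀ (F : Feasible m) (I : InfoStructure n) (ω : I.Profile), ω.1 ∈ Icc (0 : Values n) 1 →
      ∑ i, (secondPrice (optimalReserve m) F I).x i ω ≤ 1) ∧
    -- `F*` is feasible, and `(F*, I₀)` and `S_{G*}` satisfy the saddle point inequalities
    (∃ hF : IsFeasible m (worstCase m),
      (∀ M ∈ Mechanism.competitive m, ∀ (F : Feasible m) (I : InfoStructure n),
        Mechanism.revenue ⟨worstCase m, hF⟩ (InfoStructure.null n) M
            ≤ Mechanism.revenue ⟨worstCase m, hF⟩ (InfoStructure.null n)
              (secondPrice (optimalReserve m)) ∧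
        Mechanism.revenue ⟨worstCase m, hF⟩ (InfoStructure.null n)
              (secondPrice (optimalReserve m))
            ≤ Mechanism.revenue F I (secondPrice (optimalReserve m))) ∧
      -- the first inequality only needs a direct mechanism `D = (x, t)`, as a function of the
      -- reported values, that is competitive in the environment `(F*, I₀)`
      (∀ D : DirectMechanism (InfoStructure.null n),
        D.IsCompetitive (⟨worstCase m, hF⟩ : Feasible m) →
          D.revenue (worstCase m)
            ≤ Mechanism.revenue ⟨worstCase m, hF⟩ (InfoStructure.null n)
              (secondPrice (optimalReserve m)))) ∧
    -- `S_{G*}` maximizes the revenue guarantee among the competitive mechanisms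
    (∀ M ∈ Mechanism.competitive m,
      Mechanism.guarantee M ≤ Mechanism.guarantee (secondPrice (optimalReserve m) : Mechanism m)) := by
  have hn1 : 1 ≤ n := by omega
  have ha := (alpha_spec hn1 hm hanti).1
  have hprob := isProbabilityMeasure_optimalReserve hn1 hm hanti
  have hG := ae_optimalReserve_mem ha
  have hF := isFeasible_worstCase hn1 hm hanti
  have hlower := alpha_le_revenue hn hm hanti
  have hstar := revenue_worstCase hn hm hanti hF (InfoStructure.null n)
  have hupper : ∀ D : DirectMechanism (InfoStructure.null n),
      D.IsCompetitive (⟨worstCase m, hF⟩ : Feasible m) → D.revenue (worstCase m) ≤ alpha m :=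
    fun D hD => revenue_le_alpha hn1 hm hanti hF hD
  refine ⟨⟨hprob, hG⟩, fun F I => isCompetitive_secondPrice hn hG ae_optimalReserve_ne F I,
    fun F I ω _ => sum_secondPrice_x_le hn1 F I ω,
    ⟨hF, fun M hM F I => ⟨?_, ?_⟩, fun D hD => ?_⟩, fun M hM => ?_⟩
  · rw [hstar]; exact hupper _ (hM _ _)
  · rw [hstar]; exact hlower F I
  · rw [hstar]; exact hupper D hD
  -- The guarantee of `M` is at most its revenue at `(F*, I₀)`, hence at most `α`, which bounds
  -- every revenue of `S_{G*}` from below.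
  · refine (iInf₂_le (⟨worstCase m, hF⟩ : Feasible m) (InfoStructure.null n)).trans
      (le_iInf₂ fun F I => EReal.coe_le_coe_iff.2 ?_)
    exact (hupper _ (hM _ _)).trans (hlower F I)
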